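/- Let $K$ be a field of characteristic $0$ with algebraic closure $\bar K$, and let $R=K[x_1,\ldots,x_n]$ with variables ordered $x_1<\cdots<x_n$ and the lexicographic term order. **Notions.** The leading variable of $P\in R\setminus K$ is the greatest variable occurring in $P$; the initial $\mathrm{ini}(P)$ is the leading coefficient of $P$ with respect to it. A triangular set is a list $[T_1,\ldots,T_r]$ of nonconstant polynomials with strictly increasing leading variables (the empty list is admitted), or a trivial list $[c]$ with $c\in K\setminus\{0\}$. With $J$ the product of the initials, $\mathrm{sat}(T)=\{P: PJ^k\in\langle T\rangle\text{ for some }k\ge 0\}$; in particular $\mathrm{sat}([c])=\langle 1\rangle$ and $\mathrm{sat}([\,])=\langle 0\rangle$. $T$ is regular if, for every $i$, $\mathrm{ini}(T_i)$ is neither zero nor a zero divisor in $R/\mathrm{sat}([T_1,\ldots,T_{i-1}])$ (for $T=[c]$ put $\mathrm{ini}(c)=c$, so $[c]$ is regular). The W-characteristic set of an ideal is formed by the constants and, for each $i$, the smallest polynomial with leading variable $x_i$ (if any) in its reduced Gröbner basis, in increasing order of leading variables. A strong regular characteristic pair (src pair) is a pair $(G,C)$ where $G$ is a reduced Gröbner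 basis, $C$ is the W-characteristic set of $\langle G\rangle$, $\mathrm{sat}(C)=\langle G\rangle$, and $C$ is regular. It is an src divisor of an ideal $I$ if moreover $I:\langle G\rangle\neq I$. Zero sets $Z(\cdot)$ are taken in $\bar K^n$. **Algorithms.** * $\mathrm{srcPair}(I)$: while the W-characteristic set $C$ of $I$ has $\mathrm{sat}(C)\neq I$, replace $I$ by $\mathrm{sat}(C)$; then return the reduced Gröbner basis and the W-characteristic set of $I$. * $\mathrm{srcDiv}(I)$, for $I\ne\langle1\rangle$: search from the node $N=I$. At a node $N$ compute $(G,C)=\mathrm{srcPair}(N)$. If $I:\langle G\rangle\ne I$, return $(G,C)$. Otherwise let $C^*$ be the W-characteristic set of $N$. If $\mathrm{sat}(C^*)=N$, the search fails at $N$. If not, choose any $F\in\mathrm{sat}(C^*)\setminus N$ and any $H_1,\ldots,H_t\in R\setminus N$ such that $H_1\cdots H_t$ and $F\prod_{P\in C^*}\mathrm{ini}(P)$ have the same zeros in $\bar K^n$, and search from the nodes $\langle N\cup\{H_i\}\rangle$, in any order, until a pair is returned; if the search fails at all of them, it fails at $N$. * $\mathrm{srcDec}(F)$, for a finite $F\subset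 R$: start with $\Psi=\emptyset$ and $I=\langle F\rangle$; while $I\ne\langle 1\rangle$, compute $(G,C)=\mathrm{srcDiv}(I)$, adjoin $(G,C)$ to $\Psi$, and replace $I$ by $I:\langle G\rangle$; finally return $\Psi$. **Theorem.** 1. For every ideal $I$, $\mathrm{srcPair}(I)$ terminates, and it returns an src pair $(G,C)$ with $I\subseteq\langle G\rangle$. 2. Whatever choices are made, the search in $\mathrm{srcDiv}$ is never stuck (whenever $\mathrm{sat}(C^*)\neq N$ there is an admissible choice of $F$ and the $H_i$) and terminates (there is no infinite chain of successive nodes). For $I\ne\langle1\rangle$ it never fails, and it returns an src divisor $(G,C)$ of $I$ with $I\subseteq\langle G\rangle$. 3. Whatever choices are made, $\mathrm{srcDec}$ is never stuck and terminates. Hence it returns some $\Psi$ for every finite set $F\subset R$, and every $\Psi=\{(G_1,C_1),\ldots,(G_e,C_e)\}$ that it can return is a finite set of src pairs with $G_i\ne\{1\}$ and satisfies $$\sqrt{\langle F\rangle}=\bigcap_{i=1}^e\sqrt{\mathrm{sat}(C_i)}=\bigcap_{i=1}^e\sqrt{\langle G_i\rangle},\qquad Z(F)=\bigcup_{i=1}^e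 Z(G_i)=\bigcup_{i=1}^e Z(\mathrm{sat}(C_i)).$$ If $\langle F\rangle=\langle1\rangle$, then $\Psi=\emptyset$ (empty intersections being $R$); if $F$ contains a nonzero polynomial, then all $C_i$ are nonempty. 4. For every finite $F\subset R$ and every finite set of pairs $(G_i,C_i)$, where $G_i\subset R$ is a finite set and $C_i$ is a finite list in $R$, the displayed ideal relations hold if and only if the displayed zero relations hold. -/

import Mathlib

open MvPolynomial

namespace SrcDec

variable {K : Type*} [Field K] {n : ℕ}

/-- The lexicographic term order on the monomials in `x_0, …, x_{n-1}` with
`x_0 < x_1 < ⋯ < x_{n-1}`. (Mathlib's `MonomialOrder.lex` makes the variable with the smallest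
index the greatest one, hence the order dual.) -/
noncomputable def lexOrder (n : ℕ) : MonomialOrder (Fin n) where
  syn := Lex ((Fin n)ᵒᵈ →₀ ℕ)
  toSyn := (Finsupp.domCongr OrderDual.toDual).trans
    { toEquiv := toLex
      map_add' := toLex_add }
  toSyn_monotone := by
    intro a b h
    refine Finsupp.toLex_monotone ?_
    intro i
    exact h (OrderDual.ofDual i)

/-- Terms are compared by the exponent of the greatest variable in which they differ. -/
theorem lexOrder_lt_iff (a b : Fin n →₀ ℕ) :
    (lexOrder n).toSyn a < (lexOrder n).toSyn b ↔ ∃ i, (∀ j, i < j → a j = b j) ∧ a i < b i := by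
  have h : (lexOrder n).toSyn a < (lexOrder n).toSyn b ↔
      Finsupp.Lex (fun i j : (Fin n)ᵒᵈ => i < j) (fun p q : ℕ => p < q)
        (Finsupp.domCongr OrderDual.toDual a) (Finsupp.domCongr OrderDual.toDual b) := Iff.rfl
  rw [h]
  exact Iff.rfl

/-- The leading variable: the (index of the) greatest variable that occurs in `F`;
it is `⊥` exactly when `F` is a constant. -/
noncomputable def lv (F : MvPolynomial (Fin n) K) : WithBot (Fin n) :=
  F.vars.max

/-- The coefficient of `F` with respect to the highest power of `x_i` that occurs in `F`. -/
noncomputable def coeffTop (i : Fin n) (F : MvPolynomial (Fin n) K) : MvPolynomial (Fin n) K :=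
  ∑ m ∈ F.support with m i = F.degreeOf i, monomial (m.erase i) (F.coeff m)

/-- The initial of `F`: the leading coefficient of `F` with respect to its leading variable
(a constant is its own initial). -/
noncomputable def ini (F : MvPolynomial (Fin n) K) : MvPolynomial (Fin n) K :=
  WithBot.recBotCoe F (fun i => coeffTop i F) (lv F)

/-- The product of the initials of the polynomials in `T`. -/
noncomputable def iniProd (T : List (MvPolynomial (Fin n) K)) : MvPolynomial (Fin n) K :=
  (T.map ini).prod

/-- The ideal generated by the polynomials in `T`. -/
noncomputable def listIdeal (T : List (MvPolynomial (Fin n) K)) : Ideal (MvPolynomial (Fin n) K) :=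
  Ideal.span {P | P ∈ T}

/-- The saturated ideal `sat(T) = {P | P J ^ k ∈ ⟨T⟩ for some k}`, where `J` is the product of the
initials of the polynomials in `T`. -/
noncomputable def sat (T : List (MvPolynomial (Fin n) K)) : Ideal (MvPolynomial (Fin n) K) where
  carrier := {P | ∃ k : ℕ, P * iniProd T ^ k ∈ listIdeal T}
  add_mem' := by
    rintro P Q ⟨a, ha⟩ ⟨b, hb⟩
    refine ⟨a + b, ?_⟩
    have h : (P + Q) * iniProd T ^ (a + b)
        = iniProd T ^ b * (P * iniProd T ^ a) + iniProd T ^ a * (Q * iniProd T ^ b) := by ring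
    rw [h]
    exact Ideal.add_mem _ (Ideal.mul_mem_left _ _ ha) (Ideal.mul_mem_left _ _ hb)
  zero_mem' := ⟨0, by simp⟩
  smul_mem' := by
    rintro c P ⟨a, ha⟩
    refine ⟨a, ?_⟩
    rw [smul_eq_mul, mul_assoc]
    exact Ideal.mul_mem_left _ _ ha

/-- Triangular sets: either nonconstant polynomials with strictly increasing leading variables,
or a trivial one `[c]` with a nonzero constant `c`. (The empty list is admitted; it is the
W-characteristic set of the zero ideal.) -/
def IsTriangularSet (T : List (MvPolynomial (Fin n) K)) : Prop :=
  ((∀ P ∈ T, lv P ≠ ⊥) ∧ T.Pairwise (fun P Q => lv P < lv Q)) ∨ ∃ c : K, c ≠ 0 ∧ T = [C c]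

/-- Regular sets (regular chains): triangular sets `[T_1, …, T_r]` such that the initial of `T_i` is
neither zero nor a zero divisor modulo `sat([T_1, …, T_{i-1}])`, for all `i`. -/
def IsRegularSet (T : List (MvPolynomial (Fin n) K)) : Prop :=
  IsTriangularSet T ∧ ∀ i : Fin T.length,
    Ideal.Quotient.mk (sat (T.take i)) (ini (T.get i)) ≠ 0 ∧
    Ideal.Quotient.mk (sat (T.take i)) (ini (T.get i)) ∈
      nonZeroDivisors (MvPolynomial (Fin n) K ⧸ sat (T.take i))

/-- `G` is a (lex) Gröbner basis of the ideal `I`. -/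
def IsGB (G : Finset (MvPolynomial (Fin n) K)) (I : Ideal (MvPolynomial (Fin n) K)) : Prop :=
  (G : Set (MvPolynomial (Fin n) K)) ⊆ I ∧
    Ideal.span ((lexOrder n).leadingTerm '' (G : Set (MvPolynomial (Fin n) K)))
      = Ideal.span ((lexOrder n).leadingTerm '' (I : Set (MvPolynomial (Fin n) K)))

/-- `G` is the reduced (lex) Gröbner basis of the ideal `I`: its elements are monic and no term of
one of them is divisible by the leading term of another one. -/
def IsReducedGB (G : Finset (MvPolynomial (Fin n) K)) (I : Ideal (MvPolynomial (Fin n) K)) :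
    Prop :=
  IsGB G I ∧ (∀ P ∈ G, (lexOrder n).Monic P) ∧
    ∀ P ∈ G, ∀ Q ∈ G, Q ≠ P → ∀ m ∈ P.support, ¬ (lexOrder n).degree Q ≤ m

/-- `T` is the W-characteristic set of the ideal `I`: it consists of the smallest polynomial of
each leading variable (and of the constants) in the reduced Gröbner basis of `I`, listed with
increasing leading variables. -/
def IsWCharSet (T : List (MvPolynomial (Fin n) K)) (I : Ideal (MvPolynomial (Fin n) K)) : Prop :=
  ∃ G : Finset (MvPolynomial (Fin n) K), IsReducedGB G I ∧
    T.Pairwise (fun P Q => lv P < lv Q) ∧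
    ∀ P, P ∈ T ↔ P ∈ G ∧ ∀ Q ∈ G, lv Q = lv P →
      (lexOrder n).toSyn ((lexOrder n).degree P) ≤ (lexOrder n).toSyn ((lexOrder n).degree Q)

/-- Pairs `(G, C)` of polynomial sets, the second one ordered. -/
abbrev PolyPair (n : ℕ) (K : Type*) [Field K] : Type _ :=
  Finset (MvPolynomial (Fin n) K) × List (MvPolynomial (Fin n) K)

/-- The ideal `⟨G⟩` of a pair `(G, C)`. -/
noncomputable def PolyPair.ideal (p : PolyPair n K) : Ideal (MvPolynomial (Fin n) K) :=
  Ideal.span (p.1 : Set (MvPolynomial (Fin n) K))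

/-- `(G, C)` is a characteristic pair: `G` is a reduced lex Gröbner basis and `C` is the
W-characteristic set of `⟨G⟩`. -/
def IsCharPair (p : PolyPair n K) : Prop :=
  IsReducedGB p.1 p.ideal ∧ IsWCharSet p.2 p.ideal

/-- Strong regular characteristic (src) pairs. -/
def IsSrcPair (p : PolyPair n K) : Prop :=
  IsCharPair p ∧ sat p.2 = p.ideal ∧ IsRegularSet p.2

/-- The ideal quotient `I : J`. -/
noncomputable def quot (I J : Ideal (MvPolynomial (Fin n) K)) : Ideal (MvPolynomial (Fin n) K) :=
  I.colon (J : Set (MvPolynomial (Fin n) K))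

/-- `J` divides `I` if `I : J ≠ I`. -/
def Divides (J I : Ideal (MvPolynomial (Fin n) K)) : Prop :=
  quot I J ≠ I

/-- `(G, C)` is an src divisor of `I`: an src pair whose ideal `⟨G⟩ = sat(C)` divides `I`. -/
def IsSrcDivisor (p : PolyPair n K) (I : Ideal (MvPolynomial (Fin n) K)) : Prop :=
  IsSrcPair p ∧ Divides p.ideal I

/-- The procedure `srcPair`: `SrcPair I (G, C)` says that it returns `(G, C)` on input `I`.
As long as `sat(C) ≠ I` for the W-characteristic set `C` of `I`, the ideal `I` is replaced
by `sat(C)`; then the reduced Gröbner basis and the W-characteristic set of `I` are returned. -/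
inductive SrcPair : Ideal (MvPolynomial (Fin n) K) → PolyPair n K → Prop
  | done {I : Ideal (MvPolynomial (Fin n) K)} {G : Finset (MvPolynomial (Fin n) K)}
      {T : List (MvPolynomial (Fin n) K)} :
      IsReducedGB G I → IsWCharSet T I → sat T = I → SrcPair I (G, T)
  | saturate {I : Ideal (MvPolynomial (Fin n) K)} {T : List (MvPolynomial (Fin n) K)}
      {p : PolyPair n K} :
      IsWCharSet T I → sat T ≠ I → SrcPair (sat T) p → SrcPair I p

/-- An admissible choice of the polynomials `H_1, …, H_t` by which the procedure `srcDiv` branches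
at an ideal `N` with W-characteristic set `T`: there is an `F` in `sat(T)` but not in `N`, no `H_i`
is in `N`, and over the algebraic closure `H_1 ⋯ H_t = 0` if and only if `F J = 0`, where `J` is the
product of the initials of `T`. -/
def IsBranching (N : Ideal (MvPolynomial (Fin n) K)) (T Hs : List (MvPolynomial (Fin n) K)) :
    Prop :=
  ∃ F ∈ sat T, F ∉ N ∧ (∀ H ∈ Hs, H ∉ N) ∧
    ∀ x : Fin n → AlgebraicClosure K, aeval x Hs.prod = 0 ↔ aeval x (F * iniProd T) = 0

/-- The nondeterministic search in the procedure `srcDiv` for an src divisor of `I`.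
`SrcSearch I N o` says that the search below the node `N` can end with outcome `o`: a pair found
(`some p`) or a failure (`none`). If the pair `srcPair N` divides `I`, it is the outcome. Otherwise
the search fails at `N` if `N = sat(T)` for the W-characteristic set `T` of `N` (in particular if
`N = ⟨1⟩`); if `sat(T) ≠ N`, polynomials `H_1, …, H_t` are chosen and the
search continues with the ideals `⟨N ∪ {H_i}⟩`, in any order; it fails at `N` if it fails at
all of them. -/
inductive SrcSearch (I : Ideal (MvPolynomial (Fin n) K)) :
    Ideal (MvPolynomial (Fin n) K) → Option (PolyPair n K) → Prop
  | hit {N : Ideal (MvPolynomial (Fin n) K)} {p : PolyPair n K} :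
      SrcPair N p → Divides p.ideal I → SrcSearch I N (some p)
  | leaf {N : Ideal (MvPolynomial (Fin n) K)} {p : PolyPair n K}
      {T : List (MvPolynomial (Fin n) K)} :
      SrcPair N p → ¬ Divides p.ideal I → IsWCharSet T N → sat T = N → SrcSearch I N none
  | branchHit {N : Ideal (MvPolynomial (Fin n) K)} {p q : PolyPair n K}
      {T Hs : List (MvPolynomial (Fin n) K)} {H : MvPolynomial (Fin n) K} :
      SrcPair N p → ¬ Divides p.ideal I → IsWCharSet T N → sat T ≠ N → IsBranching N T Hs →
      H ∈ Hs → SrcSearch I (N ⊔ Ideal.span {H}) (some q) → SrcSearch I N (some q)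
  | branchFail {N : Ideal (MvPolynomial (Fin n) K)} {p : PolyPair n K}
      {T Hs : List (MvPolynomial (Fin n) K)} :
      SrcPair N p → ¬ Divides p.ideal I → IsWCharSet T N → sat T ≠ N → IsBranching N T Hs →
      (∀ H ∈ Hs, SrcSearch I (N ⊔ Ideal.span {H}) none) → SrcSearch I N none

/-- `SearchCall N' N`: the search at the node `N` can call itself at the node `N'`. -/
def SearchCall (N' N : Ideal (MvPolynomial (Fin n) K)) : Prop :=
  ∃ T Hs : List (MvPolynomial (Fin n) K), IsWCharSet T N ∧ sat T ≠ N ∧ IsBranching N T Hs ∧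
    ∃ H ∈ Hs, N' = N ⊔ Ideal.span {H}

/-- The procedure `srcDiv` can return the pair `p` on input `I`. -/
def SrcDiv (I : Ideal (MvPolynomial (Fin n) K)) (p : PolyPair n K) : Prop :=
  SrcSearch I I (some p)

/-- One pass through the loop of the algorithm `srcDec`, on states `(I, Ψ)`: while `I ≠ ⟨1⟩`, a pair
`(G, C)` returned by `srcDiv` on `I` is adjoined to `Ψ`, and `I` is replaced by `I : ⟨G⟩`. -/
inductive SrcDecStep :
    Ideal (MvPolynomial (Fin n) K) × Set (PolyPair n K) →
    Ideal (MvPolynomial (Fin n) K) × Set (PolyPair n K) → Prop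
  | mk {I : Ideal (MvPolynomial (Fin n) K)} {Ψ : Set (PolyPair n K)} {p : PolyPair n K} :
      I ≠ ⊤ → SrcDiv I p → SrcDecStep (I, Ψ) (quot I p.ideal, insert p Ψ)

/-- The algorithm `srcDec` can return `Ψ` on input `F`: it starts in the state `(⟨F⟩, ∅)`
and stops in a state `(⟨1⟩, Ψ)`. -/
def SrcDecReturns (F : Finset (MvPolynomial (Fin n) K)) (Ψ : Set (PolyPair n K)) : Prop :=
  Relation.ReflTransGen SrcDecStep
    (Ideal.span (F : Set (MvPolynomial (Fin n) K)), ∅) (⊤, Ψ)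

/-- The common zeros of a set of polynomials over the algebraic closure of `K`. -/
def zeros (S : Set (MvPolynomial (Fin n) K)) : Set (Fin n → AlgebraicClosure K) :=
  {x | ∀ P ∈ S, aeval x P = 0}

/-- `√⟨F⟩ = ⋂ √sat(C) = ⋂ √⟨G⟩`, over all pairs `(G, C)` in `Ψ`. -/
def IdealDecomposition (F : Finset (MvPolynomial (Fin n) K)) (Ψ : Set (PolyPair n K)) : Prop :=
  (Ideal.span (F : Set (MvPolynomial (Fin n) K))).radical = ⨅ p ∈ Ψ, (sat p.2).radical ∧
  (Ideal.span (F : Set (MvPolynomial (Fin n) K))).radical = ⨅ p ∈ Ψ, p.ideal.radical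

/-- `Z(F) = ⋃ Z(G) = ⋃ Z(sat(C))`, over all pairs `(G, C)` in `Ψ`. -/
def ZeroDecomposition (F : Finset (MvPolynomial (Fin n) K)) (Ψ : Set (PolyPair n K)) : Prop :=
  zeros (F : Set (MvPolynomial (Fin n) K))
    = ⋃ p ∈ Ψ, zeros (p.1 : Set (MvPolynomial (Fin n) K)) ∧
  zeros (F : Set (MvPolynomial (Fin n) K))
    = ⋃ p ∈ Ψ, zeros (sat p.2 : Set (MvPolynomial (Fin n) K))

end SrcDec

open SrcDec

/-!
Let `T` be the W-characteristic set of `I`. Every nonzero `P ∈ I` has a leading term divisible by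
that of some element of the reduced Gröbner basis, hence has at least the degree of some `t ∈ T` in
the leading variable `x_j` of `t`. Expanding over `K[x_1, …, x_{j-1}]`, one step of pseudo-division
by `t` lowers the leading term of `P`, so `P` reduces to zero and `I ⊆ sat(T)`. The ideals met
by `srcPair` therefore ascend.

If `sat(T) = I` and `P · ini(T_i) ∈ sat(T_1, …, T_{i-1})`, then the coefficients of `P` over
`K[x_1, …, x_{j-1}]`, where `x_j` is the leading variable of `T_i`, lie in `sat(T) = I`. An element
of `I` in these variables is pseudo-reduced to zero by `T_1, …, T_{i-1}` alone, so `T` is regular.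

For `srcDiv`, the relation `F J ^ k ∈ ⟨T⟩ ⊆ N` shows that every prime above `N` contains one of the
branching polynomials `H_i`. A failing search could thus be followed inside an associated prime
`I : a` down to a leaf, whose ideal is contained in `I : a` and hence divides `I`. For `srcDec`,
`√I = √(I : J) ∩ √J` whenever `I ⊆ J`, and the quotients ascend strictly.
-/

namespace SrcDec

variable {K : Type*} [Field K] {n : ℕ}

section ReducedGroebnerBasis

variable {σ : Type*} (o : MonomialOrder σ)

/-- The exponents of the leading terms of the nonzero polynomials in `S`. -/
def leadingExponents (S : Set (MvPolynomial σ K)) : Set (σ →₀ ℕ) :=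
  o.degree '' (S \ {0})

variable {o} {I : Ideal (MvPolynomial σ K)}

theorem degree_mem_leadingExponents {S : Set (MvPolynomial σ K)} {P : MvPolynomial σ K}
    (hP : P ∈ S) (hP0 : P ≠ 0) : o.degree P ∈ leadingExponents o S :=
  ⟨P, ⟨hP, hP0⟩, rfl⟩

theorem isUpperSet_leadingExponents (I : Ideal (MvPolynomial σ K)) :
    IsUpperSet (leadingExponents o (I : Set (MvPolynomial σ K))) := by
  rintro _ b hab ⟨P, ⟨hP, hP0⟩, rfl⟩
  have hmon : monomial (b - o.degree P) (1 : K) ≠ 0 := by simp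
  refine ⟨monomial (b - o.degree P) 1 * P, ⟨I.mul_mem_left _ hP, mul_ne_zero hmon hP0⟩, ?_⟩
  classical
  rw [o.degree_mul hmon hP0, o.degree_monomial, if_neg one_ne_zero, tsub_add_cancel_of_le hab]

theorem leadingTerm_mem_span_leadingTerm_iff {S : Set (MvPolynomial σ K)}
    {P : MvPolynomial σ K} (hP : P ≠ 0) :
    o.leadingTerm P ∈ Ideal.span (o.leadingTerm '' S) ↔
      ∃ m ∈ leadingExponents o S, m ≤ o.degree P := by
  classical
  rw [o.span_leadingTerm_eq_span_monomial',
    ← Set.image_image (fun m => monomial m (1 : K)) o.degree, mem_ideal_span_monomial_image,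
    o.support_leadingTerm' hP]
  simp only [Finset.mem_singleton, forall_eq, leadingExponents]

theorem span_leadingTerm_eq_iff {S : Set (MvPolynomial σ K)} (hS : S ⊆ I) :
    Ideal.span (o.leadingTerm '' S) = Ideal.span (o.leadingTerm '' (I : Set (MvPolynomial σ K))) ↔
      ∀ m ∈ leadingExponents o (I : Set (MvPolynomial σ K)),
        ∃ m' ∈ leadingExponents o S, m' ≤ m := by
  constructor
  · rintro h _ ⟨P, ⟨hP, hP0⟩, rfl⟩
    rw [← leadingTerm_mem_span_leadingTerm_iff hP0, h]
    exact Ideal.subset_span ⟨P, hP, rfl⟩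
  · refine fun h => le_antisymm (Ideal.span_mono (Set.image_mono hS)) (Ideal.span_le.2 ?_)
    rintro _ ⟨P, hP, rfl⟩
    rcases eq_or_ne P 0 with rfl | hP0
    · simp
    · exact (leadingTerm_mem_span_leadingTerm_iff hP0).2
        (h _ (degree_mem_leadingExponents hP hP0))

theorem exists_mem_span_sub_support (o : MonomialOrder σ) (S : Set (MvPolynomial σ K))
    (P : MvPolynomial σ K) :
    ∃ Q ∈ Ideal.span S, o.toSyn (o.degree Q) ≤ o.toSyn (o.degree P) ∧
      ∀ m ∈ (P - Q).support, ∀ m' ∈ leadingExponents o S, ¬ m' ≤ m := by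
  obtain ⟨g, r, hP, hdeg, hr⟩ := o.div_set (B := S \ {0})
    (fun b hb => o.isUnit_leadingCoeff.2 hb.2) P
  refine ⟨Finsupp.linearCombination (MvPolynomial σ K)
    (fun b : ↥(S \ {0}) => (b : MvPolynomial σ K)) g, ?_, ?_, ?_⟩
  · rw [Finsupp.linearCombination_apply]
    exact Ideal.sum_mem _ fun b _ => Ideal.mul_mem_left _ _ (Ideal.subset_span b.2.1)
  · rw [Finsupp.linearCombination_apply]
    refine o.degree_sum_le.trans (Finset.sup_le fun b _ => ?_)
    simpa only [smul_eq_mul, mul_comm] using hdeg b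
  · rintro m hm _ ⟨b, hb, rfl⟩
    exact hr m (by rwa [← sub_eq_of_eq_add' hP]) b hb

theorem span_eq_of_forall_leadingExponents {S : Set (MvPolynomial σ K)} (hS : S ⊆ I)
    (h : ∀ m ∈ leadingExponents o (I : Set (MvPolynomial σ K)),
      ∃ m' ∈ leadingExponents o S, m' ≤ m) : Ideal.span S = I := by
  refine le_antisymm (Ideal.span_le.2 hS) fun P hP => ?_
  obtain ⟨Q, hQ, -, hPQ⟩ := exists_mem_span_sub_support o S P
  suffices P - Q = 0 by rwa [sub_eq_zero.1 this]
  by_contra h0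
  obtain ⟨m', hm', hle⟩ := h _ (degree_mem_leadingExponents
    (I.sub_mem hP (Ideal.span_le.2 hS hQ)) h0)
  exact hPQ _ (o.degree_mem_support h0) m' hm' hle

theorem exists_monic_reduced {μ : σ →₀ ℕ}
    (hμ : μ ∈ leadingExponents o (I : Set (MvPolynomial σ K))) :
    ∃ P ∈ I, o.Monic P ∧ o.degree P = μ ∧ ∀ m ∈ P.support, m ≠ μ →
      m ∉ leadingExponents o (I : Set (MvPolynomial σ K)) := by
  classical
  obtain ⟨P, hP, hdeg, hr⟩ := exists_mem_span_sub_support o (I : Set (MvPolynomial σ K))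
    (monomial μ 1)
  have hcoeff : coeff μ P = 1 := by
    have h : coeff μ (monomial μ 1 - P) = 0 :=
      notMem_support_iff.1 fun hm => hr μ hm μ hμ le_rfl
    rwa [coeff_sub, coeff_monomial, if_pos rfl, sub_eq_zero, eq_comm] at h
  have hdegP : o.degree P = μ := by
    refine o.toSyn.injective (le_antisymm (hdeg.trans (o.degree_monomial_le 1)) (o.le_degree ?_))
    simp [mem_support_iff, hcoeff]
  refine ⟨P, by rwa [Ideal.span_eq] at hP, ?_, hdegP, fun m hm hmμ hmI => hr m ?_ m hmI le_rfl⟩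
  · rw [MonomialOrder.Monic, MonomialOrder.leadingCoeff, hdegP, hcoeff]
  · simpa [mem_support_iff, coeff_monomial, hmμ.symm] using hm

variable (o) in
/-- The reduced Gröbner basis of `I`, as the set of monic elements of `I` whose leading exponent is
minimal and none of whose other exponents is a leading exponent of `I`. In this form it is
canonical, so that uniqueness is built in. -/
def reducedGroebnerBasis (I : Ideal (MvPolynomial σ K)) : Set (MvPolynomial σ K) :=
  {P | P ∈ I ∧ o.Monic P ∧
    Minimal (· ∈ leadingExponents o (I : Set (MvPolynomial σ K))) (o.degree P) ∧
    ∀ m ∈ P.support, m ≠ o.degree P → m ∉ leadingExponents o (I : Set (MvPolynomial σ K))}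

theorem exists_mem_reducedGroebnerBasis_degree_le {m : σ →₀ ℕ}
    (hm : m ∈ leadingExponents o (I : Set (MvPolynomial σ K))) :
    ∃ P ∈ reducedGroebnerBasis o I, o.degree P ≤ m := by
  obtain ⟨μ, hμm, hμ⟩ := exists_minimal_le_of_wellFoundedLT _ m hm
  obtain ⟨P, hP, hmonic, rfl, hred⟩ := exists_monic_reduced hμ.prop
  exact ⟨P, ⟨hP, hmonic, hμ, hred⟩, hμm⟩

theorem injOn_degree_reducedGroebnerBasis : Set.InjOn o.degree (reducedGroebnerBasis o I) := by
  rintro P ⟨hP, hPm, -, hPred⟩ Q ⟨hQ, hQm, -, hQred⟩ hPQ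
  by_contra hne
  have h0 : P - Q ≠ 0 := sub_ne_zero.2 hne
  set m := o.degree (P - Q)
  have hmI := degree_mem_leadingExponents (o := o) (I.sub_mem hP hQ) h0
  have hcoeff : coeff m (P - Q) ≠ 0 := mem_support_iff.1 (o.degree_mem_support h0)
  have hmP : m ≠ o.degree P := by
    intro hmP
    refine hcoeff ?_
    rw [coeff_sub, hmP, hPm.coeff_degree, hPQ, hQm.coeff_degree, sub_self]
  classical
  rcases Finset.mem_union.1 (support_sub σ _ _ (o.degree_mem_support h0)) with hs | hs
  · exact hPred m hs hmP hmI
  · exact hQred m hs (hPQ ▸ hmP) hmI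

theorem finite_reducedGroebnerBasis [Finite σ] (o : MonomialOrder σ)
    (I : Ideal (MvPolynomial σ K)) : (reducedGroebnerBasis o I).Finite := by
  have hfin : {μ | Minimal (· ∈ leadingExponents o (I : Set (MvPolynomial σ K))) μ}.Finite :=
    WellQuasiOrderedLE.finite_of_isAntichain (setOfPred_minimal_antichain _)
  refine Set.Finite.of_finite_image (hfin.subset ?_) injOn_degree_reducedGroebnerBasis
  rintro _ ⟨P, hP, rfl⟩
  exact hP.2.2.1

theorem eq_of_degree_le_of_mem_reducedGroebnerBasis {P Q : MvPolynomial σ K}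
    (hP : P ∈ reducedGroebnerBasis o I) (hQ : Q ∈ reducedGroebnerBasis o I)
    (h : o.degree P ≤ o.degree Q) : P = Q :=
  injOn_degree_reducedGroebnerBasis hP hQ (hQ.2.2.1.eq_of_le hP.2.2.1.prop h)

theorem subset_reducedGroebnerBasis {G : Set (MvPolynomial σ K)} (hGI : G ⊆ I)
    (hG : ∀ m ∈ leadingExponents o (I : Set (MvPolynomial σ K)),
      ∃ m' ∈ leadingExponents o G, m' ≤ m)
    (hmonic : ∀ P ∈ G, o.Monic P)
    (hred : ∀ P ∈ G, ∀ Q ∈ G, Q ≠ P → ∀ m ∈ P.support, ¬ o.degree Q ≤ m) :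
    G ⊆ reducedGroebnerBasis o I := by
  intro P hP
  have hdeg_mem := o.degree_mem_support (hmonic P hP).ne_zero
  have hle_of_mem : ∀ m ∈ leadingExponents o (I : Set (MvPolynomial σ K)),
      ∀ m' ∈ P.support, m ≤ m' → o.degree P ≤ m := by
    intro m hmI m' hm' hle
    obtain ⟨_, ⟨Q, ⟨hQ, -⟩, rfl⟩, hQm⟩ := hG m hmI
    obtain rfl : Q = P := by_contra fun hne => hred P hP Q hQ hne m' hm' (hQm.trans hle)
    exact hQm
  refine ⟨hGI hP, hmonic P hP,
    ⟨degree_mem_leadingExponents (hGI hP) (hmonic P hP).ne_zero,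
      fun m hm hle => hle_of_mem m hm _ hdeg_mem hle⟩,
    fun m hm hne hmI => hne (o.toSyn.injective (le_antisymm (o.le_degree hm) ?_))⟩
  exact o.toSyn_monotone (hle_of_mem m hmI m hm le_rfl)

theorem eq_reducedGroebnerBasis_iff {G : Set (MvPolynomial σ K)} :
    G = reducedGroebnerBasis o I ↔ G ⊆ I ∧
      (∀ m ∈ leadingExponents o (I : Set (MvPolynomial σ K)),
        ∃ m' ∈ leadingExponents o G, m' ≤ m) ∧
      (∀ P ∈ G, o.Monic P) ∧
      ∀ P ∈ G, ∀ Q ∈ G, Q ≠ P → ∀ m ∈ P.support, ¬ o.degree Q ≤ m := by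
  constructor
  · rintro rfl
    refine ⟨fun P hP => hP.1, fun m hm => ?_, fun P hP => hP.2.1, fun P hP Q hQ hne m hm hle => ?_⟩
    · obtain ⟨P, hP, hPm⟩ := exists_mem_reducedGroebnerBasis_degree_le hm
      exact ⟨_, degree_mem_leadingExponents hP hP.2.1.ne_zero, hPm⟩
    · have hmI := isUpperSet_leadingExponents I hle hQ.2.2.1.prop
      obtain rfl : m = o.degree P := by_contra fun hmP => hP.2.2.2 m hm hmP hmI
      exact hne (eq_of_degree_le_of_mem_reducedGroebnerBasis hQ hP hle)
  · rintro ⟨hGI, hG, hmonic, hred⟩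
    have hsub := subset_reducedGroebnerBasis hGI hG hmonic hred
    refine hsub.antisymm fun P hP => ?_
    obtain ⟨_, ⟨Q, ⟨hQ, -⟩, rfl⟩, hQP⟩ := hG _ hP.2.2.1.prop
    rwa [← eq_of_degree_le_of_mem_reducedGroebnerBasis (hsub hQ) hP hQP]

end ReducedGroebnerBasis

section IsReducedGB

variable {I : Ideal (MvPolynomial (Fin n) K)} {G : Finset (MvPolynomial (Fin n) K)}

theorem isReducedGB_iff :
    IsReducedGB G I ↔ (G : Set (MvPolynomial (Fin n) K)) = reducedGroebnerBasis (lexOrder n) I := by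
  rw [eq_reducedGroebnerBasis_iff, IsReducedGB, IsGB, and_assoc]
  refine and_congr_right fun hGI => and_congr_left' (span_leadingTerm_eq_iff hGI)

theorem exists_isReducedGB (I : Ideal (MvPolynomial (Fin n) K)) : ∃ G, IsReducedGB G I :=
  ⟨_, isReducedGB_iff.2 (finite_reducedGroebnerBasis (lexOrder n) I).coe_toFinset⟩

theorem IsReducedGB.eq {G' : Finset (MvPolynomial (Fin n) K)} (h : IsReducedGB G I)
    (h' : IsReducedGB G' I) : G = G' :=
  Finset.coe_injective ((isReducedGB_iff.1 h).trans (isReducedGB_iff.1 h').symm)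

theorem IsReducedGB.span_eq (h : IsReducedGB G I) :
    Ideal.span (G : Set (MvPolynomial (Fin n) K)) = I :=
  span_eq_of_forall_leadingExponents h.1.1 ((span_leadingTerm_eq_iff h.1.1).1 h.1.2)

theorem IsReducedGB.eq_of_degree_le (h : IsReducedGB G I) {P Q : MvPolynomial (Fin n) K}
    (hP : P ∈ G) (hQ : Q ∈ G) (hPQ : (lexOrder n).degree P ≤ (lexOrder n).degree Q) : P = Q := by
  have hG := isReducedGB_iff.1 h
  rw [← Finset.mem_coe, hG] at hP hQ
  exact eq_of_degree_le_of_mem_reducedGroebnerBasis hP hQ hPQ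

theorem IsReducedGB.exists_degree_le (h : IsReducedGB G I) {P : MvPolynomial (Fin n) K}
    (hP : P ∈ I) (hP0 : P ≠ 0) : ∃ Q ∈ G, (lexOrder n).degree Q ≤ (lexOrder n).degree P := by
  obtain ⟨_, ⟨Q, ⟨hQ, -⟩, rfl⟩, hQP⟩ := (span_leadingTerm_eq_iff h.1.1).1 h.1.2 _
    (degree_mem_leadingExponents hP hP0)
  exact ⟨Q, hQ, hQP⟩

end IsReducedGB

section CoeffOver

variable {σ R : Type*} [CommSemiring R] {s t : Set σ}

theorem monomial_mem_supported {m : σ →₀ ℕ} (hm : ∀ i, m i ≠ 0 → i ∈ s) (r : R) :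
    monomial m r ∈ supported R s := by
  refine mem_supported.2 fun i hi => ?_
  obtain ⟨a, ha, hia⟩ := (mem_vars_iff_mem_support i).1 hi
  rw [Finset.mem_singleton.1 (support_monomial_subset ha)] at hia
  exact hm i (Finsupp.mem_support_iff.1 hia)

variable [DecidablePred (· ∈ s)]

theorem mem_supported_iff_filter_eq_zero {P : MvPolynomial σ R} :
    P ∈ supported R s ↔ ∀ m ∈ P.support, m.filter (· ∉ s) = 0 := by
  simp only [mem_supported, Finsupp.filter_eq_zero_iff, Set.subset_def, Finset.mem_coe,
    mem_vars_iff_mem_support, Finsupp.mem_support_iff]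
  exact ⟨fun h m hm i hi => by_contra fun hmi => hi (h i ⟨m, hm, hmi⟩),
    fun h i ⟨m, hm, hmi⟩ => by_contra fun hi => hmi (h m hm i hi)⟩

open Classical in
/-- The coefficient of `x ^ e` in `P`, regarded as a polynomial in the variables outside `s` over
the ring of polynomials in the variables in `s`. It is kept inside `MvPolynomial σ R`, as an element
of `supported R s`, and vanishes if `e` involves a variable in `s`. -/
noncomputable def coeffOver (s : Set σ) [DecidablePred (· ∈ s)] (e : σ →₀ ℕ) :
    MvPolynomial σ R →ₗ[R] MvPolynomial σ R :=
  (basisMonomials σ R).constr R fun m =>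
    if m.filter (· ∉ s) = e then monomial (m.filter (· ∈ s)) 1 else 0

open Classical in
theorem coeffOver_monomial (e m : σ →₀ ℕ) (r : R) :
    coeffOver s e (monomial m r) =
      if m.filter (· ∉ s) = e then monomial (m.filter (· ∈ s)) r else 0 := by
  have h := (basisMonomials σ R).constr_basis R (fun m : σ →₀ ℕ =>
    if m.filter (· ∉ s) = e then (monomial (m.filter (· ∈ s)) (1 : R)) else 0) m
  rw [coe_basisMonomials] at h
  rw [← mul_one r, ← smul_eq_mul, ← smul_monomial, map_smul, coeffOver, h, smul_ite, smul_zero,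
    smul_monomial]

theorem coeffOver_eq_sum [DecidableEq σ] (e : σ →₀ ℕ) (P : MvPolynomial σ R) :
    coeffOver s e P = ∑ m ∈ P.support with m.filter (· ∉ s) = e,
      monomial (m.filter (· ∈ s)) (P.coeff m) := by
  conv_lhs => rw [P.as_sum, map_sum]
  rw [Finset.sum_filter]
  refine Finset.sum_congr rfl fun m _ => ?_
  rw [coeffOver_monomial]
  congr

theorem coeff_filter_coeffOver (m : σ →₀ ℕ) (P : MvPolynomial σ R) :
    coeff (m.filter (· ∈ s)) (coeffOver s (m.filter (· ∉ s)) P) = coeff m P := by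
  classical
  induction P using MvPolynomial.induction_on' with
  | add P Q hP hQ => rw [map_add, coeff_add, coeff_add, hP, hQ]
  | monomial a r =>
    have hsplit : a = m ↔
        a.filter (· ∉ s) = m.filter (· ∉ s) ∧ a.filter (· ∈ s) = m.filter (· ∈ s) := by
      refine ⟨fun h => by rw [h]; exact ⟨rfl, rfl⟩, fun h => ?_⟩
      rw [← a.filter_add_filter_not (· ∈ s), ← m.filter_add_filter_not (· ∈ s), h.1, h.2]
    simp only [coeffOver_monomial, coeff_monomial, hsplit, ite_and]
    split_ifs <;> simp_all

theorem coeffOver_filter_ne_zero {m : σ →₀ ℕ} {P : MvPolynomial σ R} (hm : m ∈ P.support) :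
    coeffOver s (m.filter (· ∉ s)) P ≠ 0 := by
  intro h
  rw [mem_support_iff, ← coeff_filter_coeffOver (s := s), h, coeff_zero] at hm
  exact hm rfl

theorem exists_mem_support_of_coeffOver_ne_zero {e : σ →₀ ℕ} {P : MvPolynomial σ R}
    (h : coeffOver s e P ≠ 0) : ∃ m ∈ P.support, m.filter (· ∉ s) = e := by
  classical
  contrapose! h
  rw [coeffOver_eq_sum, Finset.filter_false_of_mem h, Finset.sum_empty]

theorem coeffOver_mem_supported {P : MvPolynomial σ R} (e : σ →₀ ℕ) (hP : P ∈ supported R t) :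
    coeffOver s e P ∈ supported R (s ∩ t) := by
  classical
  rw [coeffOver_eq_sum]
  refine Subalgebra.sum_mem _ fun m hm => monomial_mem_supported (fun i hi => ?_) _
  rw [Finsupp.filter_apply, ite_ne_right_iff] at hi
  refine ⟨hi.1, mem_supported.1 hP ?_⟩
  exact (mem_vars_iff_mem_support i).2
    ⟨m, (Finset.mem_filter.1 hm).1, Finsupp.mem_support_iff.2 hi.2⟩

theorem coeffOver_add_monomial_mul (a e : σ →₀ ℕ) (r : R) (P : MvPolynomial σ R) :
    coeffOver s (a.filter (· ∉ s) + e) (monomial a r * P) =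
      monomial (a.filter (· ∈ s)) r * coeffOver s e P := by
  classical
  induction P using MvPolynomial.induction_on' with
  | add P Q hP hQ => rw [mul_add, map_add, map_add, mul_add, hP, hQ]
  | monomial m c =>
    simp only [monomial_mul, coeffOver_monomial, Finsupp.filter_add, add_right_inj, mul_ite,
      mul_zero]

theorem coeffOver_mul_of_mem_supported {A : MvPolynomial σ R} (hA : A ∈ supported R s)
    (e : σ →₀ ℕ) (P : MvPolynomial σ R) : coeffOver s e (A * P) = A * coeffOver s e P := by
  have hterm : ∀ a ∈ A.support, coeffOver s e (monomial a (A.coeff a) * P) =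
      monomial a (A.coeff a) * coeffOver s e P := by
    intro a ha
    have ha0 := mem_supported_iff_filter_eq_zero.1 hA a ha
    have has : a.filter (· ∈ s) = a := by
      conv_rhs => rw [← a.filter_add_filter_not (· ∈ s), ha0, add_zero]
    simpa only [ha0, has, zero_add] using coeffOver_add_monomial_mul (s := s) a e (A.coeff a) P
  calc coeffOver s e (A * P)
      = ∑ a ∈ A.support, coeffOver s e (monomial a (A.coeff a) * P) := by
        rw [← map_sum, ← Finset.sum_mul, ← A.as_sum]
    _ = ∑ a ∈ A.support, monomial a (A.coeff a) * coeffOver s e P := Finset.sum_congr rfl hterm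
    _ = A * coeffOver s e P := by rw [← Finset.sum_mul, ← A.as_sum]

theorem exists_filter_eq_of_mem_support_mul {A P : MvPolynomial σ R} (hA : A ∈ supported R s)
    {m : σ →₀ ℕ} (hm : m ∈ (A * P).support) :
    ∃ b ∈ P.support, m.filter (· ∉ s) = b.filter (· ∉ s) := by
  have h := coeffOver_filter_ne_zero (s := s) hm
  rw [coeffOver_mul_of_mem_supported hA] at h
  obtain ⟨b, hb, hbm⟩ := exists_mem_support_of_coeffOver_ne_zero (right_ne_zero_of_mul h)
  exact ⟨b, hb, hbm.symm⟩

theorem sum_coeffOver_mul_monomial [DecidableEq σ] (s : Set σ) [DecidablePred (· ∈ s)]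
    (P : MvPolynomial σ R) :
    ∑ e ∈ P.support.image (·.filter (· ∉ s)), coeffOver s e P * monomial e 1 = P := by
  conv_rhs => rw [P.as_sum, ← Finset.sum_fiberwise_of_maps_to fun m hm =>
    Finset.mem_image_of_mem (fun m : σ →₀ ℕ => m.filter (· ∉ s)) hm]
  refine Finset.sum_congr rfl fun e _ => ?_
  rw [coeffOver_eq_sum, Finset.sum_mul]
  refine Finset.sum_congr rfl fun m hm => ?_
  rw [monomial_mul, mul_one, ← (Finset.mem_filter.1 hm).2, Finsupp.filter_add_filter_not]

theorem mem_of_forall_coeffOver_mem {J : Ideal (MvPolynomial σ R)} {P : MvPolynomial σ R}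
    (h : ∀ e, coeffOver s e P ∈ J) : P ∈ J := by
  classical
  rw [← sum_coeffOver_mul_monomial s P]
  exact J.sum_mem fun e _ => J.mul_mem_right _ (h e)

theorem coeffOver_mem_span {D : Set (MvPolynomial σ R)} (hD : ∀ d ∈ D, d ∈ supported R s)
    (e : σ →₀ ℕ) {P : MvPolynomial σ R} (hP : P ∈ Ideal.span D) :
    coeffOver s e P ∈ Ideal.span D := by
  obtain ⟨g, rfl⟩ := (Finsupp.mem_span_iff_linearCombination _ D P).1 hP
  rw [Finsupp.linearCombination_apply, Finsupp.sum, map_sum]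
  refine Ideal.sum_mem _ fun d _ => ?_
  rw [smul_eq_mul, mul_comm, coeffOver_mul_of_mem_supported (hD d d.2)]
  exact Ideal.mul_mem_right _ _ (Ideal.subset_span d.2)

end CoeffOver

section LeadingVariable

variable {P t : MvPolynomial (Fin n) K} {j : Fin n} {s : Set (Fin n)}

theorem apply_eq_zero_of_lv_lt (h : lv P = j) {m : Fin n →₀ ℕ} (hm : m ∈ P.support) {i : Fin n}
    (hi : j < i) : m i = 0 := by
  by_contra hmi
  have hle : (i : WithBot (Fin n)) ≤ lv P :=
    Finset.le_max ((mem_vars_iff_mem_support i).2 ⟨m, hm, Finsupp.mem_support_iff.2 hmi⟩)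
  exact hi.not_ge (WithBot.coe_le_coe.1 (h ▸ hle))

theorem lv_lt_coe_iff : lv P < j ↔ P ∈ supported K (Set.Iio j) := by
  rw [lv, Finset.max, Finset.sup_lt_iff (WithBot.bot_lt_coe j), mem_supported]
  exact forall₂_congr fun _ _ => WithBot.coe_lt_coe

theorem mem_supported_of_lv_eq (hs : IsLowerSet s) (h : lv P = j) (hj : j ∈ s) :
    P ∈ supported K s :=
  mem_supported.2 fun _ hi => hs (WithBot.coe_le_coe.1 (h ▸ Finset.le_max hi)) hj

theorem degreeOf_pos_of_lv_eq (h : lv P = j) : 0 < P.degreeOf j := by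
  obtain ⟨m, hm, hjm⟩ := (mem_vars_iff_mem_support j).1 (Finset.mem_of_max h)
  exact (Nat.pos_of_ne_zero (Finsupp.mem_support_iff.1 hjm)).trans_le (monomial_le_degreeOf j hm)

theorem ne_zero_of_lv_eq (h : lv P = j) : P ≠ 0 := by
  rintro rfl
  simpa using degreeOf_pos_of_lv_eq h

theorem filter_notMem_Iio_eq_single (h : lv P = j) {m : Fin n →₀ ℕ} (hm : m ∈ P.support) :
    m.filter (· ∉ Set.Iio j) = Finsupp.single j (m j) := by
  ext i
  rcases lt_trichotomy i j with hi | rfl | hi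
  · simp [hi, hi.ne']
  · simp
  · rw [Finsupp.filter_apply, apply_eq_zero_of_lv_lt h hm hi, ite_self,
      Finsupp.single_eq_of_ne hi.ne']

theorem filter_mem_Iio_eq_erase (h : lv P = j) {m : Fin n →₀ ℕ} (hm : m ∈ P.support) :
    m.filter (· ∈ Set.Iio j) = m.erase j := by
  refine add_right_cancel (b := Finsupp.single j (m j)) ?_
  rw [Finsupp.erase_add_single, ← filter_notMem_Iio_eq_single h hm,
    Finsupp.filter_add_filter_not]

theorem toSyn_lt_of_toSyn_filter_lt [DecidablePred (· ∈ s)] (hs : IsLowerSet s) {a b : Fin n →₀ ℕ}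
    (h : (lexOrder n).toSyn (a.filter (· ∉ s)) < (lexOrder n).toSyn (b.filter (· ∉ s))) :
    (lexOrder n).toSyn a < (lexOrder n).toSyn b := by
  obtain ⟨i, heq, hlt⟩ := (lexOrder_lt_iff _ _).1 h
  have hi : i ∉ s := fun hi => by simp [hi] at hlt
  refine (lexOrder_lt_iff _ _).2 ⟨i, fun k hik => ?_, by simpa [hi] using hlt⟩
  have hk : k ∉ s := fun hk => hi (hs hik.le hk)
  simpa [hk] using heq k hik

theorem toSyn_filter_le_of_mem_support_mul [DecidablePred (· ∈ s)] (hs : IsLowerSet s)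
    {A : MvPolynomial (Fin n) K} (hA : A ∈ supported K s) {m : Fin n →₀ ℕ}
    (hm : m ∈ (A * P).support) :
    (lexOrder n).toSyn (m.filter (· ∉ s)) ≤
      (lexOrder n).toSyn (((lexOrder n).degree P).filter (· ∉ s)) := by
  obtain ⟨b, hb, hmb⟩ := exists_filter_eq_of_mem_support_mul hA hm
  rw [hmb]
  exact not_lt.1 fun hlt => ((lexOrder n).le_degree hb).not_gt (toSyn_lt_of_toSyn_filter_lt hs hlt)

theorem mem_vars_of_degree_apply_ne_zero {i : Fin n} (h : (lexOrder n).degree P i ≠ 0) :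
    i ∈ P.vars := by
  have hP : P ≠ 0 := by
    rintro rfl
    simp at h
  exact (mem_vars_iff_mem_support i).2
    ⟨_, (lexOrder n).degree_mem_support hP, Finsupp.mem_support_iff.2 h⟩

theorem degree_apply_eq_degreeOf (h : lv P = j) : (lexOrder n).degree P j = P.degreeOf j := by
  have hdeg := (lexOrder n).degree_mem_support (ne_zero_of_lv_eq h)
  refine le_antisymm (monomial_le_degreeOf j hdeg) ((degreeOf_le_iff).2 fun m hm => ?_)
  by_contra! hlt
  refine ((lexOrder n).le_degree hm).not_gt ((lexOrder_lt_iff _ _).2 ⟨j, fun i hi => ?_, hlt⟩)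
  rw [apply_eq_zero_of_lv_lt h hm hi, apply_eq_zero_of_lv_lt h hdeg hi]

theorem eq_C_of_lv_eq_bot (h : lv P = ⊥) : P = C (coeff 0 P) :=
  vars_eq_empty_iff_eq_C.1 (Finset.max_eq_bot.1 h)

theorem ini_of_lv_eq_bot (h : lv P = ⊥) : ini P = P := by
  rw [ini, h, WithBot.recBotCoe_bot]

theorem ini_eq_coeffOver (h : lv P = j) :
    ini P = coeffOver (Set.Iio j) (Finsupp.single j (P.degreeOf j)) P := by
  rw [ini, h, WithBot.recBotCoe_coe, coeffTop, coeffOver_eq_sum]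
  refine Finset.sum_congr (Finset.filter_congr fun m hm => ?_) fun m hm => ?_
  · rw [filter_notMem_Iio_eq_single h hm, (Finsupp.single_injective j).eq_iff]
  · rw [filter_mem_Iio_eq_erase h (Finset.mem_filter.1 hm).1]

theorem ini_mem_supported_Iio (h : lv P = j) : ini P ∈ supported K (Set.Iio j) := by
  have hP : P ∈ supported K Set.univ := mem_supported.2 (Set.subset_univ _)
  rw [ini_eq_coeffOver h]
  exact supported_mono Set.inter_subset_left (coeffOver_mem_supported _ hP)

theorem ini_mem_supported (hP : P ∈ supported K s) : ini P ∈ supported K s := by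
  cases h : lv P with
  | bot => rwa [ini_of_lv_eq_bot h]
  | coe j =>
    rw [ini_eq_coeffOver h]
    exact supported_mono Set.inter_subset_right (coeffOver_mem_supported _ hP)

theorem ini_ne_zero (h : lv P = j) : ini P ≠ 0 := by
  have hdeg := (lexOrder n).degree_mem_support (ne_zero_of_lv_eq h)
  rw [ini_eq_coeffOver h, ← degree_apply_eq_degreeOf h, ← filter_notMem_Iio_eq_single h hdeg]
  exact coeffOver_filter_ne_zero hdeg

theorem add_single_mem_support_of_mem_support_ini (h : lv P = j) {a : Fin n →₀ ℕ}
    (ha : a ∈ (ini P).support) : a + Finsupp.single j (P.degreeOf j) ∈ P.support := by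
  rw [ini_eq_coeffOver h, coeffOver_eq_sum] at ha
  obtain ⟨m, hm, ham⟩ := Finset.mem_biUnion.1 (support_sum ha)
  obtain ⟨hm, hme⟩ := Finset.mem_filter.1 hm
  rwa [Finset.mem_singleton.1 (support_monomial_subset ham), ← hme, Finsupp.filter_add_filter_not]

theorem coeffOver_monomial_mul_eq_ini (ht : lv t = j) {c : Fin n →₀ ℕ}
    (hc : c.filter (· ∈ Set.Iio j) = 0) :
    coeffOver (Set.Iio j) (c + Finsupp.single j (t.degreeOf j)) (monomial c 1 * t) = ini t := by
  have hc' : c.filter (· ∉ Set.Iio j) = c := by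
    conv_rhs => rw [← c.filter_add_filter_not (· ∈ Set.Iio j), hc, zero_add]
  have h := coeffOver_add_monomial_mul (s := Set.Iio j) c (Finsupp.single j (t.degreeOf j)) 1 t
  rwa [hc', hc, ← ini_eq_coeffOver ht, monomial_zero', C_1, one_mul] at h

theorem filter_notMem_Iio_le_of_mem_support_monomial_mul (ht : lv t = j) {c m : Fin n →₀ ℕ}
    (hm : m ∈ (monomial c (1 : K) * t).support) :
    m.filter (· ∉ Set.Iio j) ≤ c + Finsupp.single j (t.degreeOf j) := by
  have hc : c.filter (· ∉ Set.Iio j) ≤ c := by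
    intro i
    rw [Finsupp.filter_apply]
    split_ifs
    · exact Nat.zero_le _
    · exact le_rfl
  obtain ⟨_, ha, b, hb, rfl⟩ := Finset.mem_add.1 (support_mul _ _ hm)
  rw [Finset.mem_singleton.1 (support_monomial_subset ha), Finsupp.filter_add,
    filter_notMem_Iio_eq_single ht hb]
  exact add_le_add hc (Finsupp.single_mono (monomial_le_degreeOf j hb))

theorem exists_add_single_eq_filter_notMem_Iio {m : Fin n →₀ ℕ} {d : ℕ} (h : d ≤ m j) :
    ∃ c : Fin n →₀ ℕ, c ≤ m ∧ c.filter (· ∈ Set.Iio j) = 0 ∧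
      c + Finsupp.single j d = m.filter (· ∉ Set.Iio j) := by
  have hfilter : m.filter (· ∉ Set.Iio j) ≤ m := fun i => by
    rw [Finsupp.filter_apply]
    split_ifs <;> simp
  refine ⟨m.filter (· ∉ Set.Iio j) - Finsupp.single j d, tsub_le_self.trans hfilter, ?_, ?_⟩
  · rw [Finsupp.filter_eq_zero_iff]
    intro i hi
    simp [Set.mem_Iio.1 hi]
  · refine tsub_add_cancel_of_le (Finsupp.single_le_iff.2 ?_)
    rwa [Finsupp.filter_apply_pos _ _ (by simp)]

theorem exists_pseudoRemainder (ht : lv t = j) (hle : t.degreeOf j ≤ (lexOrder n).degree P j) :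
    ∃ q ∈ supported K (P.vars : Set (Fin n)), ∀ m ∈ (ini t * P - q * t).support,
      (lexOrder n).toSyn m < (lexOrder n).toSyn ((lexOrder n).degree P) := by
  set e := ((lexOrder n).degree P).filter (· ∉ Set.Iio j) with he
  obtain ⟨c, hcP, hc0, hce⟩ := exists_add_single_eq_filter_notMem_Iio hle
  rw [← he] at hce
  have hini := ini_mem_supported_Iio ht
  have hA := coeffOver_mem_supported (s := Set.Iio j) e (mem_supported_vars P)
  have hA_Iio := supported_mono Set.inter_subset_left hA
  have hc : monomial c (1 : K) ∈ supported K (P.vars : Set (Fin n)) :=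
    monomial_mem_supported (fun i hi => mem_vars_of_degree_apply_ne_zero
      ((Nat.pos_of_ne_zero hi).trans_le (hcP i)).ne') 1
  -- With this quotient the coefficients of `x ^ e` over `K[x_1, …, x_{j-1}]` cancel.
  refine ⟨coeffOver (Set.Iio j) e P * monomial c 1,
    mul_mem (supported_mono Set.inter_subset_right hA) hc, fun m hm => ?_⟩
  refine toSyn_lt_of_toSyn_filter_lt (isLowerSet_Iio j) (lt_of_le_of_ne ?_ fun hme => ?_)
  · rcases Finset.mem_union.1 (support_sub _ _ _ hm) with hm | hm
    · exact toSyn_filter_le_of_mem_support_mul (isLowerSet_Iio j) hini hm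
    · rw [mul_assoc] at hm
      obtain ⟨b, hb, hmb⟩ := exists_filter_eq_of_mem_support_mul hA_Iio hm
      rw [hmb]
      refine (lexOrder n).toSyn_monotone ?_
      exact (filter_notMem_Iio_le_of_mem_support_monomial_mul ht hb).trans_eq hce
  · refine coeffOver_filter_ne_zero (s := Set.Iio j) hm ?_
    rw [(lexOrder n).toSyn.injective hme, ← he, map_sub, mul_assoc,
      coeffOver_mul_of_mem_supported hini, coeffOver_mul_of_mem_supported hA_Iio, ← hce,
      coeffOver_monomial_mul_eq_ini ht hc0, hce, mul_comm, sub_self]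

end LeadingVariable

section PairwiseLt

variable {α β : Type*} [LinearOrder β] {f : α → β}

theorem exists_pairwise_lt_of_injOn {S : Finset α} (hf : Set.InjOn f S) :
    ∃ l : List α, l.Pairwise (fun a b => f a < f b) ∧ ∀ a, a ∈ l ↔ a ∈ S := by
  classical
  have : Std.Total fun a b => f a ≤ f b := ⟨fun _ _ => le_total _ _⟩
  have : IsTrans α fun a b => f a ≤ f b := ⟨fun _ _ _ => le_trans⟩
  set l := S.toList.insertionSort fun a b => f a ≤ f b
  have hmem : ∀ a, a ∈ l ↔ a ∈ S := fun a => (List.mem_insertionSort _).trans Finset.mem_toList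
  have hnodup : l.Nodup := (List.perm_insertionSort _ _).nodup_iff.2 S.nodup_toList
  refine ⟨l, (hnodup.and (List.pairwise_insertionSort _ _)).imp_of_mem ?_, hmem⟩
  rintro a b ha hb ⟨hne, hle⟩
  exact hle.lt_of_ne fun hab => hne (hf ((hmem a).1 ha) ((hmem b).1 hb) hab)

theorem eq_of_pairwise_lt {l l' : List α} (hl : l.Pairwise fun a b => f a < f b)
    (hl' : l'.Pairwise fun a b => f a < f b) (h : ∀ a, a ∈ l ↔ a ∈ l') : l = l' := by
  have : Std.Antisymm fun a b => f a < f b := ⟨fun _ _ hab hba => (hab.asymm hba).elim⟩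
  have : Std.Irrefl fun a b => f a < f b := ⟨fun _ => lt_irrefl _⟩
  exact hl.eq_of_mem_iff hl' h

theorem mem_take_iff_of_pairwise_lt {l : List α} (hl : l.Pairwise fun a b => f a < f b) {i : ℕ}
    (hi : i < l.length) {a : α} : a ∈ l.take i ↔ a ∈ l ∧ f a < f l[i] := by
  have hdrop := List.drop_eq_getElem_cons hi
  have happ := hl
  rw [← List.take_append_drop i l, hdrop, List.pairwise_append] at happ
  obtain ⟨-, hdrop_lt, htake_lt⟩ := happ
  refine ⟨fun ha => ⟨List.mem_of_mem_take ha, htake_lt a ha _ List.mem_cons_self⟩, ?_⟩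
  rintro ⟨ha, hlt⟩
  rw [← List.take_append_drop i l, hdrop, List.mem_append, List.mem_cons] at ha
  rcases ha with ha | rfl | ha
  · exact ha
  · exact (lt_irrefl _ hlt).elim
  · exact (hlt.asymm (List.rel_of_pairwise_cons hdrop_lt ha)).elim

end PairwiseLt

section Sat

variable {T : List (MvPolynomial (Fin n) K)} {P t : MvPolynomial (Fin n) K}

theorem listIdeal_le_sat (T : List (MvPolynomial (Fin n) K)) : listIdeal T ≤ sat T :=
  fun _ hP => ⟨0, by simpa using hP⟩

theorem sat_mono {D : List (MvPolynomial (Fin n) K)} (h : D.Sublist T) : sat D ≤ sat T := by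
  rintro P ⟨k, hk⟩
  obtain ⟨A, hA⟩ : iniProd D ∣ iniProd T := (h.map ini).prod_dvd_prod
  refine ⟨k, ?_⟩
  rw [hA, mul_pow, ← mul_assoc]
  exact Ideal.mul_mem_right _ _ (Ideal.span_mono (fun _ hd => h.subset hd) hk)

theorem mem_sat_of_ini_mul_mem_sat (ht : t ∈ T) (h : ini t * P ∈ sat T) : P ∈ sat T := by
  obtain ⟨k, hk⟩ := h
  obtain ⟨A, hA⟩ : ini t ∣ iniProd T := List.dvd_prod (List.mem_map_of_mem ht)
  refine ⟨k + 1, ?_⟩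
  have hmul : P * iniProd T ^ (k + 1) = A * (ini t * P * iniProd T ^ k) := by
    rw [pow_succ]
    nth_rw 2 [hA]
    ring
  rw [hmul]
  exact Ideal.mul_mem_left _ _ hk

theorem sat_nil : sat ([] : List (MvPolynomial (Fin n) K)) = ⊥ := by
  refine eq_bot_iff.2 ?_
  rintro P ⟨k, hk⟩
  simpa [iniProd, listIdeal] using hk

theorem iniProd_mem_supported {s : Set (Fin n)} (hT : ∀ t ∈ T, t ∈ supported K s) :
    iniProd T ∈ supported K s := by
  refine Subalgebra.list_prod_mem _ fun A hA => ?_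
  obtain ⟨t, ht, rfl⟩ := List.mem_map.1 hA
  exact ini_mem_supported (hT t ht)

theorem coeffOver_mem_sat {s : Set (Fin n)} [DecidablePred (· ∈ s)]
    (hT : ∀ t ∈ T, t ∈ supported K s) (e : Fin n →₀ ℕ) (hP : P ∈ sat T) :
    coeffOver s e P ∈ sat T := by
  obtain ⟨k, hk⟩ := hP
  refine ⟨k, ?_⟩
  rw [mul_comm, ← coeffOver_mul_of_mem_supported (pow_mem (iniProd_mem_supported hT) k), mul_comm]
  exact coeffOver_mem_span hT e hk

end Sat

section IsWCharSet

variable {I : Ideal (MvPolynomial (Fin n) K)} {G : Finset (MvPolynomial (Fin n) K)}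
  {T D : List (MvPolynomial (Fin n) K)} {P t : MvPolynomial (Fin n) K} {j : Fin n}

theorem IsReducedGB.eq_one_of_lv_eq_bot (h : IsReducedGB G I) (hP : P ∈ G) (hlv : lv P = ⊥) :
    P = 1 := by
  have hC := eq_C_of_lv_eq_bot hlv
  have hmonic := (h.2.1 P hP).leadingCoeff_eq_one
  rw [hC, MonomialOrder.leadingCoeff_C] at hmonic
  rw [hC, hmonic, C_1]

theorem IsReducedGB.eq_one_of_one_mem (h : IsReducedGB G I) (h1 : 1 ∈ G) (hP : P ∈ G) : P = 1 :=
  (h.eq_of_degree_le h1 hP (by rw [MonomialOrder.degree_one]; exact zero_le)).symm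

theorem exists_isWCharSet (I : Ideal (MvPolynomial (Fin n) K)) : ∃ T, IsWCharSet T I := by
  classical
  obtain ⟨G, hG⟩ := exists_isReducedGB I
  let S := G.filter fun P => ∀ Q ∈ G, lv Q = lv P →
    (lexOrder n).toSyn ((lexOrder n).degree P) ≤ (lexOrder n).toSyn ((lexOrder n).degree Q)
  have hinj : Set.InjOn lv (S : Set (MvPolynomial (Fin n) K)) := by
    intro P hP Q hQ hPQ
    obtain ⟨hPG, hPmin⟩ := Finset.mem_filter.1 hP
    obtain ⟨hQG, hQmin⟩ := Finset.mem_filter.1 hQ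
    refine hG.eq_of_degree_le hPG hQG (le_of_eq ((lexOrder n).toSyn.injective ?_))
    exact le_antisymm (hPmin Q hQG hPQ.symm) (hQmin P hPG hPQ)
  obtain ⟨T, hT, hmem⟩ := exists_pairwise_lt_of_injOn hinj
  exact ⟨T, G, hG, hT, fun P => (hmem P).trans Finset.mem_filter⟩

theorem IsWCharSet.pairwise (h : IsWCharSet T I) : T.Pairwise fun P Q => lv P < lv Q := by
  obtain ⟨G, -, hT, -⟩ := h
  exact hT

theorem IsWCharSet.eq (h : IsWCharSet T I) (h' : IsWCharSet D I) : T = D := by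
  obtain ⟨G, hG, hT, hmem⟩ := h
  obtain ⟨G', hG', hD, hmem'⟩ := h'
  obtain rfl := hG.eq hG'
  exact eq_of_pairwise_lt hT hD fun P => (hmem P).trans (hmem' P).symm

theorem IsWCharSet.mem (h : IsWCharSet T I) (ht : t ∈ T) : t ∈ I := by
  obtain ⟨G, hG, -, hmem⟩ := h
  exact hG.1.1 ((hmem t).1 ht).1

theorem IsWCharSet.eq_singleton_one (h : IsWCharSet T I) (ht : t ∈ T) (hlv : lv t = ⊥) :
    T = [1] := by
  have hT := h.pairwise
  obtain ⟨G, hG, -, hmem⟩ := h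
  have htG := ((hmem t).1 ht).1
  obtain rfl := hG.eq_one_of_lv_eq_bot htG hlv
  have hall : ∀ P ∈ T, P = 1 := fun P hP => hG.eq_one_of_one_mem htG ((hmem P).1 hP).1
  refine eq_of_pairwise_lt hT (List.pairwise_singleton _ _) fun P => ?_
  rw [List.mem_singleton]
  exact ⟨hall P, fun hP => hP ▸ ht⟩

theorem IsWCharSet.isTriangularSet (h : IsWCharSet T I) : IsTriangularSet T := by
  by_cases hconst : ∃ t ∈ T, lv t = ⊥
  · obtain ⟨t, ht, hlv⟩ := hconst
    exact Or.inr ⟨1, one_ne_zero, by rw [h.eq_singleton_one ht hlv, C_1]⟩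
  · exact Or.inl ⟨by simpa only [not_exists, not_and] using hconst, h.pairwise⟩

theorem degreeOf_le_degreeOf_of_toSyn_degree_le {Q : MvPolynomial (Fin n) K} (hP : lv P = j)
    (hQ : lv Q = j) (h : (lexOrder n).toSyn ((lexOrder n).degree P) ≤
      (lexOrder n).toSyn ((lexOrder n).degree Q)) : P.degreeOf j ≤ Q.degreeOf j := by
  rw [← degree_apply_eq_degreeOf hP, ← degree_apply_eq_degreeOf hQ]
  by_contra! hlt
  refine h.not_gt ((lexOrder_lt_iff _ _).2 ⟨j, fun i hi => ?_, hlt⟩)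
  rw [apply_eq_zero_of_lv_lt hP ((lexOrder n).degree_mem_support (ne_zero_of_lv_eq hP)) hi,
    apply_eq_zero_of_lv_lt hQ ((lexOrder n).degree_mem_support (ne_zero_of_lv_eq hQ)) hi]

theorem IsWCharSet.exists_reducer (h : IsWCharSet T I) (hP : P ∈ I) (hP0 : P ≠ 0) :
    ∃ t ∈ T, t = 1 ∨ ∃ j : Fin n, lv t = j ∧ t.degreeOf j ≤ (lexOrder n).degree P j := by
  classical
  obtain ⟨G, hG, -, hmem⟩ := h
  obtain ⟨Q, hQ, hQP⟩ := hG.exists_degree_le hP hP0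
  obtain ⟨t, ht, hmin⟩ := Finset.exists_min_image (G.filter (lv · = lv Q))
    (fun R => (lexOrder n).toSyn ((lexOrder n).degree R)) ⟨Q, Finset.mem_filter.2 ⟨hQ, rfl⟩⟩
  obtain ⟨htG, htQ⟩ := Finset.mem_filter.1 ht
  refine ⟨t, (hmem t).2 ⟨htG, fun R hR hRt =>
    hmin R (Finset.mem_filter.2 ⟨hR, hRt.trans htQ⟩)⟩, ?_⟩
  cases hlv : lv Q with
  | bot => exact Or.inl (hG.eq_one_of_lv_eq_bot htG (htQ.trans hlv))
  | coe j =>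
    refine Or.inr ⟨j, htQ.trans hlv, ?_⟩
    calc t.degreeOf j ≤ Q.degreeOf j := degreeOf_le_degreeOf_of_toSyn_degree_le (htQ.trans hlv) hlv
          (hmin Q (Finset.mem_filter.2 ⟨hQ, rfl⟩))
      _ = (lexOrder n).degree Q j := (degree_apply_eq_degreeOf hlv).symm
      _ ≤ (lexOrder n).degree P j := hQP j

theorem IsWCharSet.mem_sat (h : IsWCharSet T I) {s : Set (Fin n)}
    (hD : ∀ t ∈ T, t ∈ supported K s → t ∈ D) (hs : IsLowerSet s)
    (hP : P ∈ I) (hPs : P ∈ supported K s) : P ∈ sat D := by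
  induction hd : (lexOrder n).toSyn ((lexOrder n).degree P) using WellFoundedLT.induction
    generalizing P with
  | ind d ih =>
  subst hd
  by_cases hP0 : P = 0
  · exact hP0 ▸ zero_mem _
  obtain ⟨t, ht, rfl | ⟨j, hj, hle⟩⟩ := h.exists_reducer hP hP0
  · have h1 : (1 : MvPolynomial (Fin n) K) ∈ listIdeal D :=
      Ideal.subset_span (hD 1 ht (one_mem _))
    exact listIdeal_le_sat D ((Ideal.eq_top_of_isUnit_mem _ h1 isUnit_one) ▸ Submodule.mem_top)
  have hjP : j ∈ P.vars :=
    mem_vars_of_degree_apply_ne_zero ((degreeOf_pos_of_lv_eq hj).trans_le hle).ne'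
  have hts : t ∈ supported K s :=
    mem_supported_of_lv_eq hs hj (mem_supported.1 hPs hjP)
  obtain ⟨q, hq, hlt⟩ := exists_pseudoRemainder hj hle
  have hqs : q ∈ supported K s := supported_mono (mem_supported.1 hPs) hq
  have hrem : ini t * P - q * t ∈ sat D := by
    by_cases hrem0 : ini t * P - q * t = 0
    · exact hrem0 ▸ zero_mem _
    · exact ih _ (hlt _ ((lexOrder n).degree_mem_support hrem0))
        (sub_mem (I.mul_mem_left _ hP) (I.mul_mem_left _ (h.mem ht)))
        (sub_mem (mul_mem (ini_mem_supported hts) hPs) (mul_mem hqs hts)) rfl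
  refine mem_sat_of_ini_mul_mem_sat (hD t ht hts) ?_
  have htD : q * t ∈ sat D :=
    (sat D).mul_mem_left _ (listIdeal_le_sat D (Ideal.subset_span (hD t ht hts)))
  simpa only [sub_add_cancel] using add_mem hrem htD

theorem IsWCharSet.le_sat (h : IsWCharSet T I) : I ≤ sat T := fun _ hP =>
  h.mem_sat (s := Set.univ) (fun _ ht _ => ht) isLowerSet_univ hP (by rw [supported_univ]; trivial)

theorem IsWCharSet.ini_notMem (h : IsWCharSet T I) (ht : t ∈ T) (hj : lv t = j) : ini t ∉ I := by
  obtain ⟨G, hG, -, hmem⟩ := h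
  intro hini
  have hini0 : ini t ≠ 0 := ini_ne_zero hj
  obtain ⟨Q, hQ, hQini⟩ := hG.exists_degree_le hini hini0
  have hdeg := (lexOrder n).degree_mem_support hini0
  have hsupp := add_single_mem_support_of_mem_support_ini hj hdeg
  obtain rfl : Q = t := by
    by_contra hQt
    exact hG.2.2 t ((hmem t).1 ht).1 Q hQ hQt _ hsupp (hQini.trans le_self_add)
  have hzero : (lexOrder n).degree (ini Q) j = 0 := by
    by_contra hne
    exact lt_irrefl j
      (mem_supported.1 (ini_mem_supported_Iio hj) (mem_vars_of_degree_apply_ne_zero hne))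
  have hpos : 0 < (lexOrder n).degree Q j := by
    rw [degree_apply_eq_degreeOf hj]
    exact degreeOf_pos_of_lv_eq hj
  exact (hpos.trans_le (hQini j)).ne' hzero

theorem IsWCharSet.mem_take_iff (h : IsWCharSet T I) {i : ℕ} (hi : i < T.length)
    (hj : lv T[i] = j) : t ∈ T.take i ↔ t ∈ T ∧ t ∈ supported K (Set.Iio j) := by
  rw [mem_take_iff_of_pairwise_lt h.pairwise hi, hj, lv_lt_coe_iff]

theorem IsWCharSet.mem_sat_take_of_mul_ini_mem (h : IsWCharSet T I) (hsat : sat T = I) {i : ℕ}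
    (hi : i < T.length) (hj : lv T[i] = j) (hP : P * ini T[i] ∈ sat (T.take i)) :
    P ∈ sat (T.take i) := by
  classical
  have hsupp : ∀ t ∈ T.take i, t ∈ supported K (Set.Iio j) :=
    fun t ht => ((h.mem_take_iff hi hj).1 ht).2
  refine mem_of_forall_coeffOver_mem (s := Set.Iio j) fun e => ?_
  have hcoeff : ini T[i] * coeffOver (Set.Iio j) e P ∈ sat (T.take i) := by
    rw [← coeffOver_mul_of_mem_supported (ini_mem_supported_Iio hj), mul_comm]
    exact coeffOver_mem_sat hsupp e hP
  have hmemI : coeffOver (Set.Iio j) e P ∈ I := hsat ▸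
    mem_sat_of_ini_mul_mem_sat (List.getElem_mem hi) (sat_mono (T.take_sublist i) hcoeff)
  refine h.mem_sat (fun t ht hts => (h.mem_take_iff hi hj).2 ⟨ht, hts⟩) (isLowerSet_Iio j)
    hmemI ?_
  simpa using coeffOver_mem_supported e (mem_supported.2 (Set.subset_univ (P.vars : Set (Fin n))))

theorem IsWCharSet.isRegularSet (h : IsWCharSet T I) (hsat : sat T = I) : IsRegularSet T := by
  refine ⟨h.isTriangularSet, ?_⟩
  rintro ⟨i, hi⟩
  rw [List.get_eq_getElem]
  cases hlv : lv T[i] with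
  | bot =>
    obtain rfl := h.eq_singleton_one (List.getElem_mem hi) hlv
    obtain rfl : i = 0 := by simpa using hi
    have : Nontrivial (_ ⧸ sat (([1] : List (MvPolynomial (Fin n) K)).take 0)) :=
      Ideal.Quotient.nontrivial_iff.2 (by rw [List.take_zero, sat_nil]; exact bot_ne_top)
    have hini : ini ([1] : List (MvPolynomial (Fin n) K))[0] = 1 := ini_of_lv_eq_bot hlv
    rw [hini, map_one]
    exact ⟨one_ne_zero, one_mem _⟩
  | coe j =>
    constructor
    · rw [Ne, Ideal.Quotient.eq_zero_iff_mem]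
      exact fun hini => h.ini_notMem (List.getElem_mem hi) hlv
        (hsat ▸ sat_mono (T.take_sublist i) hini)
    · refine mem_nonZeroDivisors_iff_right.2 fun Q hQ => ?_
      obtain ⟨P, rfl⟩ := Ideal.Quotient.mk_surjective Q
      rw [← map_mul, Ideal.Quotient.eq_zero_iff_mem] at hQ
      exact Ideal.Quotient.eq_zero_iff_mem.2 (h.mem_sat_take_of_mul_ini_mem hsat hi hlv hQ)

theorem exists_isBranching (h : IsWCharSet T I) (hsat : sat T ≠ I) :
    ∃ Hs, IsBranching I T Hs := by
  obtain ⟨F, hF, hFI⟩ := SetLike.exists_of_lt (h.le_sat.lt_of_ne hsat.symm)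
  have hini : ∀ t ∈ T, ini t ∉ I := by
    intro t ht
    cases hlv : lv t with
    | bot =>
      have h1 : (1 : MvPolynomial (Fin n) K) ∈ I := h.mem (by simp [h.eq_singleton_one ht hlv])
      exact (hFI ((Ideal.eq_top_iff_one I).2 h1 ▸ Submodule.mem_top)).elim
    | coe j => exact h.ini_notMem ht hlv
  refine ⟨F :: T.map ini, F, hF, hFI, ?_, fun x => by rw [List.prod_cons, iniProd]⟩
  simpa only [List.forall_mem_cons, List.forall_mem_map] using ⟨hFI, hini⟩

end IsWCharSet

section Nullstellensatz

variable {k L σ : Type*} [Field k] [Field L] [Algebra k L]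

theorem mem_zeroLocus_iff_le_vanishingIdeal {I : Ideal (MvPolynomial σ k)} {x : σ → L} :
    x ∈ zeroLocus L I ↔ I ≤ vanishingIdeal k {x} := by
  rw [← le_zeroLocus_iff_le_vanishingIdeal]
  exact Set.singleton_subset_iff.symm

theorem zeroLocus_radical (I : Ideal (MvPolynomial σ k)) :
    zeroLocus L I.radical = zeroLocus L I := by
  ext x
  simp only [mem_zeroLocus_iff_le_vanishingIdeal, Ideal.IsPrime.radical_le_iff inferInstance]

theorem zeroLocus_biInf {ι : Type*} {Ψ : Set ι} (hΨ : Ψ.Finite)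
    (J : ι → Ideal (MvPolynomial σ k)) :
    zeroLocus L (⨅ p ∈ Ψ, J p) = ⋃ p ∈ Ψ, zeroLocus L (J p) := by
  have hinf : ⨅ p ∈ Ψ, J p = hΨ.toFinset.inf J := by
    simp only [Finset.inf_eq_iInf, hΨ.mem_toFinset]
  ext x
  simp only [hinf, mem_zeroLocus_iff_le_vanishingIdeal, Ideal.IsPrime.inf_le' inferInstance,
    hΨ.mem_toFinset, Set.mem_iUnion, exists_prop]

variable [IsAlgClosed L] [Finite σ]

theorem zeroLocus_eq_iff_radical_eq {I J : Ideal (MvPolynomial σ k)} :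
    zeroLocus L I = zeroLocus L J ↔ I.radical = J.radical := by
  constructor <;> intro h
  · rw [← vanishingIdeal_zeroLocus_eq_radical (K := L), h, vanishingIdeal_zeroLocus_eq_radical]
  · rw [← zeroLocus_radical, h, zeroLocus_radical]

theorem zeroLocus_eq_biUnion_iff_radical_eq_biInf {ι : Type*} {Ψ : Set ι} (hΨ : Ψ.Finite)
    (I : Ideal (MvPolynomial σ k)) (J : ι → Ideal (MvPolynomial σ k)) :
    zeroLocus L I = ⋃ p ∈ Ψ, zeroLocus L (J p) ↔ I.radical = ⨅ p ∈ Ψ, (J p).radical := by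
  have hrad : (⨅ p ∈ Ψ, (J p).radical).IsRadical :=
    Ideal.isRadical_iInf _ fun p => Ideal.isRadical_iInf _ fun _ => Ideal.radical_isRadical _
  rw [← hrad.radical, ← zeroLocus_eq_iff_radical_eq (L := L), zeroLocus_biInf hΨ]
  simp only [zeroLocus_radical]

end Nullstellensatz

theorem zeros_eq_zeroLocus_span (S : Set (MvPolynomial (Fin n) K)) :
    zeros S = zeroLocus (AlgebraicClosure K) (Ideal.span S) :=
  (zeroLocus_span S).symm

theorem idealDecomposition_iff_zeroDecomposition (F : Finset (MvPolynomial (Fin n) K))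
    {Ψ : Set (PolyPair n K)} (hΨ : Ψ.Finite) :
    IdealDecomposition F Ψ ↔ ZeroDecomposition F Ψ := by
  simp only [IdealDecomposition, ZeroDecomposition, zeros_eq_zeroLocus_span, Ideal.span_eq,
    zeroLocus_eq_biUnion_iff_radical_eq_biInf hΨ]
  exact and_comm

section SrcPair

variable {I : Ideal (MvPolynomial (Fin n) K)} {T : List (MvPolynomial (Fin n) K)}
  {p : PolyPair n K}

theorem exists_srcPair (I : Ideal (MvPolynomial (Fin n) K)) : ∃ p, SrcPair I p := by
  induction I using WellFoundedGT.induction with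
  | ind I ih =>
  obtain ⟨T, hT⟩ := exists_isWCharSet I
  by_cases hsat : sat T = I
  · obtain ⟨G, hG⟩ := exists_isReducedGB I
    exact ⟨_, .done hG hT hsat⟩
  · obtain ⟨p, hp⟩ := ih (sat T) (hT.le_sat.lt_of_ne (Ne.symm hsat))
    exact ⟨p, .saturate hT hsat hp⟩

theorem SrcPair.isSrcPair (h : SrcPair I p) : IsSrcPair p := by
  induction h with
  | @done I G T hG hT hsat =>
    have hideal : PolyPair.ideal (G, T) = I := hG.span_eq
    rw [IsSrcPair, IsCharPair, hideal]
    exact ⟨⟨hG, hT⟩, hsat, hT.isRegularSet hsat⟩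
  | saturate _ _ _ ih => exact ih

theorem SrcPair.le_ideal (h : SrcPair I p) : I ≤ p.ideal := by
  induction h with
  | done hG _ _ => exact hG.span_eq.ge
  | saturate hT _ _ ih => exact hT.le_sat.trans ih

theorem SrcPair.ideal_eq (h : SrcPair I p) (hT : IsWCharSet T I) (hsat : sat T = I) :
    p.ideal = I := by
  cases h with
  | done hG _ _ => exact hG.span_eq
  | saturate hT' hne _ => exact (hne (hT.eq hT' ▸ hsat)).elim

end SrcPair

section Divides

variable {I J : Ideal (MvPolynomial (Fin n) K)}

theorem Divides.lt_quot (h : Divides J I) : I < quot I J :=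
  Ideal.le_colon.lt_of_ne (Ne.symm h)

theorem Divides.ne_top (h : Divides J I) : J ≠ ⊤ := by
  rintro rfl
  exact h Submodule.colon_univ

theorem divides_of_le_colon_singleton {a : MvPolynomial (Fin n) K} (ha : a ∉ I)
    (hJ : J ≤ I.colon {a}) : Divides J I := by
  intro h
  refine ha (h ▸ Submodule.mem_colon.2 fun P hP => ?_)
  rw [smul_eq_mul, mul_comm]
  exact Submodule.mem_colon_singleton.1 (hJ hP)

end Divides

theorem exists_isPrime_colon_singleton {R : Type*} [CommRing R] [IsNoetherianRing R] {I : Ideal R}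
    (hI : I ≠ ⊤) : ∃ a, (I.colon {a}).IsPrime := by
  obtain ⟨𝔭, h𝔭⟩ := Ideal.nonempty_minimalPrimes hI
  have hcolon : I.colon {1} = I := by
    ext r
    rw [Submodule.mem_colon_singleton, smul_eq_mul, mul_one]
  obtain ⟨a, rfl⟩ := Submodule.exists_eq_colon_of_mem_minimalPrimes (hcolon.symm ▸ h𝔭)
  exact ⟨a, h𝔭.isPrime⟩

section SrcDiv

variable {I N 𝔭 : Ideal (MvPolynomial (Fin n) K)} {T Hs : List (MvPolynomial (Fin n) K)}
  {p : PolyPair n K}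

theorem IsBranching.lt_sup_span_singleton (h : IsBranching N T Hs) {H : MvPolynomial (Fin n) K}
    (hH : H ∈ Hs) : N < N ⊔ Ideal.span {H} := by
  obtain ⟨F, -, -, hN, -⟩ := h
  exact Submodule.lt_sup_iff_notMem.2 (hN H hH)

theorem IsBranching.exists_mem_of_isPrime (h : IsBranching N T Hs) (hp : 𝔭.IsPrime)
    (hT : listIdeal T ≤ 𝔭) : ∃ H ∈ Hs, H ∈ 𝔭 := by
  obtain ⟨F, ⟨k, hk⟩, -, -, hzeros⟩ := h
  have hFJ : F * iniProd T ∈ 𝔭 := by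
    rcases hp.mem_or_mem (hT hk) with hF | hJ
    · exact 𝔭.mul_mem_right _ hF
    · exact 𝔭.mul_mem_left _ (hp.mem_of_pow_mem _ hJ)
  have hradical : (Ideal.span {Hs.prod}).radical = (Ideal.span {F * iniProd T}).radical := by
    rw [← zeroLocus_eq_iff_radical_eq (L := AlgebraicClosure K)]
    ext x
    simpa only [zeroLocus_span, Set.mem_singleton_iff, forall_eq, Set.mem_ofPred_eq] using hzeros x
  have hprod : Hs.prod ∈ 𝔭 := by
    rw [← Ideal.span_singleton_le_iff_mem, ← hp.radical_le_iff] at hFJ ⊢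
    exact hradical.trans_le hFJ
  simpa using (hp.multiset_prod_mem_iff_exists_mem Hs).1 (by simpa using hprod)

theorem wellFounded_searchCall : WellFounded (SearchCall (K := K) (n := n)) := by
  refine Subrelation.wf (r := (· > ·)) ?_ wellFounded_gt
  rintro N' N ⟨T, Hs, -, -, hHs, H, hH, rfl⟩
  exact hHs.lt_sup_span_singleton hH

theorem exists_srcSearch (I N : Ideal (MvPolynomial (Fin n) K)) : ∃ o, SrcSearch I N o := by
  induction N using WellFoundedGT.induction with
  | ind N ih =>
  obtain ⟨p, hp⟩ := exists_srcPair N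
  by_cases hdiv : Divides p.ideal I
  · exact ⟨_, .hit hp hdiv⟩
  obtain ⟨T, hT⟩ := exists_isWCharSet N
  by_cases hsat : sat T = N
  · exact ⟨_, .leaf hp hdiv hT hsat⟩
  obtain ⟨Hs, hHs⟩ := exists_isBranching hT hsat
  by_cases hsome : ∃ H ∈ Hs, ∃ q, SrcSearch I (N ⊔ Ideal.span {H}) (some q)
  · obtain ⟨H, hH, q, hq⟩ := hsome
    exact ⟨_, .branchHit hp hdiv hT hsat hHs hH hq⟩
  · refine ⟨_, .branchFail hp hdiv hT hsat hHs fun H hH => ?_⟩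
    obtain ⟨_ | q, ho⟩ := ih _ (hHs.lt_sup_span_singleton hH)
    · exact ho
    · exact (hsome ⟨H, hH, q, ho⟩).elim

theorem SrcSearch.exists_not_divides_of_isPrime (h : SrcSearch I N none) (hp : 𝔭.IsPrime)
    (hN : N ≤ 𝔭) : ∃ J ≤ 𝔭, ¬ Divides J I := by
  generalize ho : (none : Option (PolyPair n K)) = o at h
  induction h with
  | hit | branchHit => contradiction
  | @leaf N _ _ hsrc hdiv hT hsat => exact ⟨N, hN, hsrc.ideal_eq hT hsat ▸ hdiv⟩
  | branchFail _ _ hT _ hHs _ ih =>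
    obtain ⟨H, hH, hmem⟩ := hHs.exists_mem_of_isPrime hp
      ((Ideal.span_le.2 fun _ ht => hT.mem ht).trans hN)
    exact ih H hH (sup_le hN ((Ideal.span_singleton_le_iff_mem _).2 hmem)) rfl

theorem not_srcSearch_none (hI : I ≠ ⊤) : ¬ SrcSearch I I none := by
  intro h
  obtain ⟨a, hp⟩ := exists_isPrime_colon_singleton hI
  obtain ⟨J, hJ, hdiv⟩ := h.exists_not_divides_of_isPrime hp Ideal.le_colon
  have ha : a ∉ I := fun ha =>
    hp.ne_top ((Submodule.colon_eq_top_iff_subset _).2 (Set.singleton_subset_iff.2 ha))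
  exact hdiv (divides_of_le_colon_singleton ha hJ)

theorem SrcSearch.exists_srcPair (h : SrcSearch I N (some p)) :
    ∃ N', N ≤ N' ∧ SrcPair N' p ∧ Divides p.ideal I := by
  generalize ho : some p = o at h
  induction h with
  | hit hsrc hdiv => cases ho; exact ⟨_, le_rfl, hsrc, hdiv⟩
  | leaf | branchFail => contradiction
  | branchHit _ _ _ _ _ _ _ ih =>
    obtain ⟨N', hN', hfound⟩ := ih ho
    exact ⟨N', le_sup_left.trans hN', hfound⟩

theorem SrcDiv.isSrcDivisor (h : SrcDiv I p) : IsSrcDivisor p I := by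
  obtain ⟨N, -, hsrc, hdiv⟩ := SrcSearch.exists_srcPair h
  exact ⟨hsrc.isSrcPair, hdiv⟩

theorem SrcDiv.le_ideal (h : SrcDiv I p) : I ≤ p.ideal := by
  obtain ⟨N, hN, hsrc, -⟩ := SrcSearch.exists_srcPair h
  exact hN.trans hsrc.le_ideal

theorem exists_srcDiv (hI : I ≠ ⊤) : ∃ p, SrcDiv I p := by
  obtain ⟨_ | p, ho⟩ := exists_srcSearch I I
  · exact (not_srcSearch_none hI ho).elim
  · exact ⟨p, ho⟩

end SrcDiv

theorem radical_eq_radical_colon_inf_radical {R : Type*} [CommSemiring R] {I J : Ideal R}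
    (h : I ≤ J) : I.radical = (I.colon (J : Set R)).radical ⊓ J.radical := by
  refine le_antisymm (le_inf (Ideal.radical_mono Ideal.le_colon) (Ideal.radical_mono h)) ?_
  rintro P ⟨⟨a, ha⟩, ⟨b, hb⟩⟩
  exact ⟨a + b, pow_add P a b ▸ Submodule.mem_colon.1 ha _ hb⟩

section SrcDec

variable {I : Ideal (MvPolynomial (Fin n) K)} {F : Finset (MvPolynomial (Fin n) K)}
  {Ψ : Set (PolyPair n K)} {p : PolyPair n K}

theorem exists_srcDecStep (hI : I ≠ ⊤) (Ψ : Set (PolyPair n K)) : ∃ s, SrcDecStep (I, Ψ) s := by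
  obtain ⟨p, hp⟩ := exists_srcDiv hI
  exact ⟨_, .mk hI hp⟩

theorem wellFounded_srcDecStep :
    WellFounded (fun s t : Ideal (MvPolynomial (Fin n) K) × Set (PolyPair n K) =>
      SrcDecStep t s) := by
  refine Subrelation.wf (r := InvImage (· > ·) Prod.fst) ?_ (InvImage.wf _ wellFounded_gt)
  rintro s t ⟨-, hp⟩
  exact hp.isSrcDivisor.2.lt_quot

theorem exists_reflTransGen_srcDecStep (s : Ideal (MvPolynomial (Fin n) K) × Set (PolyPair n K)) :
    ∃ Ψ, Relation.ReflTransGen SrcDecStep s (⊤, Ψ) := by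
  induction s using wellFounded_srcDecStep.induction with
  | _ s ih =>
  by_cases htop : s.1 = ⊤
  · exact ⟨s.2, by rw [← htop]⟩
  · obtain ⟨t, ht⟩ := exists_srcDecStep htop s.2
    obtain ⟨Ψ, hΨ⟩ := ih t ht
    exact ⟨Ψ, .head ht hΨ⟩

theorem exists_srcDecReturns (F : Finset (MvPolynomial (Fin n) K)) : ∃ Ψ, SrcDecReturns F Ψ :=
  exists_reflTransGen_srcDecStep _

/-- The invariant of the loop of `srcDec` started at the ideal `I`: every pair collected so far was
returned by `srcDiv` on an ideal above `I`, and the collected pairs together with the current ideal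
recover `√I`. -/
structure SrcDecInvariant (I : Ideal (MvPolynomial (Fin n) K))
    (s : Ideal (MvPolynomial (Fin n) K) × Set (PolyPair n K)) : Prop where
  le : I ≤ s.1
  finite : s.2.Finite
  exists_srcDiv : ∀ p ∈ s.2, ∃ J, I ≤ J ∧ SrcDiv J p
  radical_eq : I.radical = s.1.radical ⊓ ⨅ p ∈ s.2, p.ideal.radical

theorem SrcDecInvariant.step {s t : Ideal (MvPolynomial (Fin n) K) × Set (PolyPair n K)}
    (h : SrcDecInvariant I s) (hst : SrcDecStep s t) : SrcDecInvariant I t := by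
  obtain ⟨-, hp⟩ := hst
  refine ⟨h.le.trans Ideal.le_colon, h.finite.insert _, ?_, ?_⟩
  · exact Set.forall_mem_insert.2 ⟨⟨_, h.le, hp⟩, h.exists_srcDiv⟩
  · rw [h.radical_eq, iInf_insert, ← inf_assoc]
    exact congrArg (· ⊓ _) (radical_eq_radical_colon_inf_radical hp.le_ideal)

theorem SrcDecInvariant.init (I : Ideal (MvPolynomial (Fin n) K)) : SrcDecInvariant I (I, ∅) :=
  ⟨le_rfl, Set.finite_empty, by simp, by simp⟩

theorem SrcDecInvariant.reflTransGen {s t : Ideal (MvPolynomial (Fin n) K) × Set (PolyPair n K)}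
    (h : SrcDecInvariant I s) (hst : Relation.ReflTransGen SrcDecStep s t) :
    SrcDecInvariant I t := by
  induction hst with
  | refl => exact h
  | tail _ hstep ih => exact ih.step hstep

theorem SrcDecReturns.invariant (h : SrcDecReturns F Ψ) :
    SrcDecInvariant (Ideal.span (F : Set (MvPolynomial (Fin n) K))) (⊤, Ψ) :=
  (SrcDecInvariant.init _).reflTransGen h

theorem SrcDecReturns.finite (h : SrcDecReturns F Ψ) : Ψ.Finite :=
  h.invariant.finite

theorem SrcDecReturns.isSrcPair (h : SrcDecReturns F Ψ) (hp : p ∈ Ψ) : IsSrcPair p := by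
  obtain ⟨J, -, hdiv⟩ := h.invariant.exists_srcDiv p hp
  exact hdiv.isSrcDivisor.1

theorem SrcDecReturns.ideal_ne_top (h : SrcDecReturns F Ψ) (hp : p ∈ Ψ) : p.ideal ≠ ⊤ := by
  obtain ⟨J, -, hdiv⟩ := h.invariant.exists_srcDiv p hp
  exact hdiv.isSrcDivisor.2.ne_top

theorem SrcDecReturns.span_le_ideal (h : SrcDecReturns F Ψ) (hp : p ∈ Ψ) :
    Ideal.span (F : Set (MvPolynomial (Fin n) K)) ≤ p.ideal := by
  obtain ⟨J, hJ, hdiv⟩ := h.invariant.exists_srcDiv p hp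
  exact hJ.trans hdiv.le_ideal

theorem SrcDecReturns.fst_ne_singleton_one (h : SrcDecReturns F Ψ) (hp : p ∈ Ψ) :
    p.1 ≠ {1} := by
  intro h1
  refine h.ideal_ne_top hp ?_
  rw [PolyPair.ideal, h1, Finset.coe_singleton, Ideal.span_singleton_one]

theorem SrcDecReturns.snd_ne_nil (h : SrcDecReturns F Ψ) (hF : ∃ P ∈ F, P ≠ 0) (hp : p ∈ Ψ) :
    p.2 ≠ [] := by
  intro hnil
  obtain ⟨P, hPF, hP0⟩ := hF
  have hbot : p.ideal = ⊥ := by rw [← (h.isSrcPair hp).2.1, hnil, sat_nil]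
  exact hP0 (hbot.le (h.span_le_ideal hp (Ideal.subset_span hPF)))

theorem SrcDecReturns.eq_empty (h : SrcDecReturns F Ψ)
    (hF : Ideal.span (F : Set (MvPolynomial (Fin n) K)) = ⊤) : Ψ = ∅ :=
  Set.eq_empty_of_forall_notMem fun _ hp =>
    h.ideal_ne_top hp (top_le_iff.1 (hF ▸ h.span_le_ideal hp))

theorem SrcDecReturns.idealDecomposition (h : SrcDecReturns F Ψ) : IdealDecomposition F Ψ := by
  have hrad : (Ideal.span (F : Set (MvPolynomial (Fin n) K))).radical =
      ⨅ p ∈ Ψ, p.ideal.radical := by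
    rw [h.invariant.radical_eq, Ideal.radical_top, top_inf_eq]
  exact ⟨hrad.trans (biInf_congr fun p hp => by rw [(h.isSrcPair hp).2.1]), hrad⟩

end SrcDec

end SrcDec

theorem mainTheorem3_general {K : Type*} [Field K] (n : ℕ) :
    (∀ I : Ideal (MvPolynomial (Fin n) K),
      (∃ p, SrcPair I p) ∧ ∀ p, SrcPair I p → IsSrcPair p ∧ I ≤ p.ideal) ∧
    (∀ (N : Ideal (MvPolynomial (Fin n) K)) (T : List (MvPolynomial (Fin n) K)),
      IsWCharSet T N → sat T ≠ N → ∃ Hs, IsBranching N T Hs) ∧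
    WellFounded (SearchCall (K := K) (n := n)) ∧
    (∀ I : Ideal (MvPolynomial (Fin n) K), I ≠ ⊤ →
      (∃ p, SrcDiv I p) ∧ ¬ SrcSearch I I none ∧
        ∀ p, SrcDiv I p → IsSrcDivisor p I ∧ I ≤ p.ideal) ∧
    (∀ (I : Ideal (MvPolynomial (Fin n) K)) (Ψ : Set (PolyPair n K)), I ≠ ⊤ →
      ∃ s, SrcDecStep (I, Ψ) s) ∧
    WellFounded (fun s t : Ideal (MvPolynomial (Fin n) K) × Set (PolyPair n K) =>
      SrcDecStep t s) ∧
    (∀ F : Finset (MvPolynomial (Fin n) K),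
      (∃ Ψ, SrcDecReturns F Ψ) ∧
      ∀ Ψ, SrcDecReturns F Ψ →
        Ψ.Finite ∧
        (∀ p ∈ Ψ, IsSrcPair p ∧ p.1 ≠ {1}) ∧
        ((∃ P ∈ F, P ≠ 0) → ∀ p ∈ Ψ, p.2 ≠ []) ∧
        (Ideal.span (F : Set (MvPolynomial (Fin n) K)) = ⊤ → Ψ = ∅) ∧
        IdealDecomposition F Ψ ∧
        ZeroDecomposition F Ψ) ∧
    (∀ (F : Finset (MvPolynomial (Fin n) K)) (Ψ : Set (PolyPair n K)), Ψ.Finite →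
      (IdealDecomposition F Ψ ↔ ZeroDecomposition F Ψ)) :=
  ⟨fun I => ⟨exists_srcPair I, fun _ hp => ⟨hp.isSrcPair, hp.le_ideal⟩⟩,
    fun _ _ => exists_isBranching,
    wellFounded_searchCall,
    fun _ hI => ⟨exists_srcDiv hI, not_srcSearch_none hI,
      fun _ hp => ⟨hp.isSrcDivisor, hp.le_ideal⟩⟩,
    fun _ Ψ hI => exists_srcDecStep hI Ψ,
    wellFounded_srcDecStep,
    fun F => ⟨exists_srcDecReturns F, fun _ hΨ =>
      ⟨hΨ.finite, fun _ hp => ⟨hΨ.isSrcPair hp, hΨ.fst_ne_singleton_one hp⟩,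
        fun hF _ hp => hΨ.snd_ne_nil hF hp, hΨ.eq_empty, hΨ.idealDecomposition,
        (idealDecomposition_iff_zeroDecomposition F hΨ.finite).1 hΨ.idealDecomposition⟩⟩,
    fun F _ hΨ => idealDecomposition_iff_zeroDecomposition F hΨ⟩

theorem mainTheorem3 {K : Type*} [Field K] [CharZero K] (n : ℕ) :
    -- `srcPair` returns an src pair whose ideal contains the input
    (∀ I : Ideal (MvPolynomial (Fin n) K),
      (∃ p, SrcPair I p) ∧ ∀ p, SrcPair I p → IsSrcPair p ∧ I ≤ p.ideal) ∧
    -- the search in `srcDiv` is never stuck and terminates, whatever is chosen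
    (∀ (N : Ideal (MvPolynomial (Fin n) K)) (T : List (MvPolynomial (Fin n) K)),
      IsWCharSet T N → sat T ≠ N → ∃ Hs, IsBranching N T Hs) ∧
    WellFounded (SearchCall (K := K) (n := n)) ∧
    -- on a proper ideal it never fails, and it returns src divisors that contain the ideal
    (∀ I : Ideal (MvPolynomial (Fin n) K), I ≠ ⊤ →
      (∃ p, SrcDiv I p) ∧ ¬ SrcSearch I I none ∧
        ∀ p, SrcDiv I p → IsSrcDivisor p I ∧ I ≤ p.ideal) ∧
    -- `srcDec` is never stuck and terminates, whatever is chosen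
    (∀ (I : Ideal (MvPolynomial (Fin n) K)) (Ψ : Set (PolyPair n K)), I ≠ ⊤ →
      ∃ s, SrcDecStep (I, Ψ) s) ∧
    WellFounded (fun s t : Ideal (MvPolynomial (Fin n) K) × Set (PolyPair n K) =>
      SrcDecStep t s) ∧
    -- correctness of `srcDec`
    (∀ F : Finset (MvPolynomial (Fin n) K),
      (∃ Ψ, SrcDecReturns F Ψ) ∧
      ∀ Ψ, SrcDecReturns F Ψ →
        Ψ.Finite ∧
        (∀ p ∈ Ψ, IsSrcPair p ∧ p.1 ≠ {1}) ∧
        ((∃ P ∈ F, P ≠ 0) → ∀ p ∈ Ψ, p.2 ≠ []) ∧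
        (Ideal.span (F : Set (MvPolynomial (Fin n) K)) = ⊤ → Ψ = ∅) ∧
        IdealDecomposition F Ψ ∧
        ZeroDecomposition F Ψ) ∧
    -- the two kinds of decompositions are equivalent
    (∀ (F : Finset (MvPolynomial (Fin n) K)) (Ψ : Set (PolyPair n K)), Ψ.Finite →
      (IdealDecomposition F Ψ ↔ ZeroDecomposition F Ψ)) :=
  mainTheorem3_general n
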